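/- Let $k\ge 12$ and let $f$ be a holomorphic Hecke cusp form of weight $k$ for $SL_2(\mathbb Z)$, that is, a nonzero cusp form which is an eigenfunction of all Hecke operators $T_n f(z)=n^{k-1}\sum_{ad=n}\sum_{0\le b<d}d^{-k}f\big(\tfrac{az+b}{d}\big)$, $n\ge 1$. Let $n^{\frac{k-1}{2}}\lambda_f(n)$ be the eigenvalue of $T_n$, and write $e(x)=e^{2\pi i x}$. For $\alpha\in\mathbb Q$ and a Dirichlet character $\chi$, define $$L(s,f)=\sum_{n\ge1}\frac{\lambda_f(n)}{n^s},\qquad L(s,f\otimes e(\alpha))=\sum_{n\ge1}\frac{\lambda_f(n)e(n\alpha)}{n^s},\qquad L(s,f\otimes\chi)=\sum_{n\ge1}\frac{\lambda_f(n)\chi(n)}{n^s}$$ for $\Re(s)>1$ and by analytic continuation elsewhere; these series converge absolutely for $\Re(s)>1$ and extend to entire functions of $s$. For an odd prime $q$ and integers $a,b$ put $$M_f(a,b;q)=\frac1{\phi(q)}\Big(\ \sideset{}{^*}\sum_{\chi\,(\mathrm{mod}\ q)}\tau(\chi)\,L\big(\tfrac12,f\otimes\overline{\chi}\big)\,\chi(a)\overline{\chi}(b)+\big(\lambda_f(q)q^{\frac12}-2\big)L\big(\tfrac12,f\big)\Big),$$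 where $\sum^*$ runs over the primitive characters modulo $q$ and $\tau(\chi)=\sum_{n\,(\mathrm{mod}\ q)}\chi(n)e(n/q)$. Let $p,q,r$ be distinct odd primes, and let $\overline p,\overline r$ be integers with $p\overline p\equiv1\ (\mathrm{mod}\ r)$ and $r\overline r\equiv1\ (\mathrm{mod}\ p)$. Then $$M_f(p,r;q)-M_f(-q,r;p)-M_f(-p,q;r)=\sum_{j=1}^{\frac k2-1}\frac1{j!}\frac{\Gamma(\frac k2+j)}{\Gamma(\frac k2-j)}\Big(\frac{2\pi i q}{pr}\Big)^{-j}\Big(L\big(\tfrac12+j,f\otimes e(-\tfrac{\overline p q}{r})\big)+(-1)^j i^k L\big(\tfrac12+j,f\otimes e(\tfrac{q\overline r}{p})\big)\Big).$$ In particular, there is a constant $C$ depending only on $f$ such that, for all distinct odd primes $p,q,r$, $$\big|M_f(p,r;q)-M_f(-q,r;p)-M_f(-p,q;r)\big|\le C\,\frac{pr}{q}.$$ -/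

import Mathlib

open scoped MatrixGroups UpperHalfPlane

noncomputable section

namespace HeckeReciprocity

/-! ### Hecke operators and Hecke cusp forms of level one -/

/-- The `n`-th Hecke operator of weight `k` and level one,
`(T_n f)(z) = n^(k-1) ∑_{ad = n} ∑_{0 ≤ b < d} d^(-k) f((a z + b) / d)`.
For `n ≥ 1` every argument `(a z + b) / d` lies in the upper half plane, so `ofComplex` only
bundles it as a point of `ℍ`. -/
def heckeOperator (k n : ℕ) (f : ℍ → ℂ) (z : ℍ) : ℂ :=
  (n : ℂ) ^ ((k : ℤ) - 1) *
    ∑ d ∈ n.divisors, ∑ b ∈ Finset.range d,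
      ((d : ℂ) ^ k)⁻¹ * f (UpperHalfPlane.ofComplex ((((n / d : ℕ) : ℂ) * (z : ℂ) + b) / d))

/-- `c` is an eigenvalue of `T_n` on `f`. -/
def IsHeckeEigenvalue {k : ℕ} (f : CuspForm 𝒮ℒ (k : ℤ)) (n : ℕ) (c : ℂ) : Prop :=
  ∀ z : ℍ, heckeOperator k n f z = c * f z

/-- A Hecke cusp form: a nonzero cusp form for `SL₂(ℤ)` that is an eigenfunction of every
Hecke operator `T_n`, `n ≥ 1`. -/
def IsHeckeCuspForm {k : ℕ} (f : CuspForm 𝒮ℒ (k : ℤ)) : Prop :=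
  f ≠ 0 ∧ ∀ n : ℕ, 1 ≤ n → ∃ c : ℂ, IsHeckeEigenvalue f n c

open Classical in
/-- The normalized Hecke eigenvalue `λ_f(n)`: the eigenvalue of `T_n` on `f` (which is unique as
`f ≠ 0`) divided by `n^((k-1)/2)`. -/
def lam {k : ℕ} (f : CuspForm 𝒮ℒ (k : ℤ)) (n : ℕ) : ℂ :=
  if h : ∃ c : ℂ, IsHeckeEigenvalue f n c then h.choose / (n : ℂ) ^ (((k : ℂ) - 1) / 2) else 0

/-! ### `L`-functions, by analytic continuation of Dirichlet series -/

/-- `F` is entire and is given by the absolutely convergent Dirichlet series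
`∑_{n ≥ 1} a(n) n^(-s)` for `Re s > 1`. -/
def IsEntireContinuation (a : ℕ → ℂ) (F : ℂ → ℂ) : Prop :=
  Differentiable ℂ F ∧ ∀ s : ℂ, 1 < s.re → LSeriesHasSum a s (F s)

/-- The entire continuation is unique. -/
theorem IsEntireContinuation.unique {a : ℕ → ℂ} {F G : ℂ → ℂ}
    (hF : IsEntireContinuation a F) (hG : IsEntireContinuation a G) : F = G := by
  have hopen : IsOpen {s : ℂ | 1 < s.re} := isOpen_lt continuous_const Complex.continuous_re
  refine AnalyticOnNhd.eq_of_eventuallyEq (z₀ := 2)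
    (fun z _ => hF.1.analyticAt z) (fun z _ => hG.1.analyticAt z) ?_
  filter_upwards [hopen.mem_nhds (show (1 : ℝ) < (2 : ℂ).re by norm_num)] with s hs
  exact (hF.2 s hs).unique (hG.2 s hs)

open Classical in
/-- The function obtained from `∑_{n ≥ 1} a(n) n^(-s)`, `Re s > 1`, by analytic continuation
to `ℂ` (with value `0` if there is no such continuation). -/
def continuedLSeries (a : ℕ → ℂ) (s : ℂ) : ℂ :=
  if h : ∃ F : ℂ → ℂ, IsEntireContinuation a F then h.choose s else 0

/-- The coefficients `λ_f(n) e(n α)` of the additive twist of `f` by `α`. -/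
def addTwistCoeff {k : ℕ} (f : CuspForm 𝒮ℒ (k : ℤ)) (α : ℚ) (n : ℕ) : ℂ :=
  lam f n * Complex.exp (2 * Real.pi * Complex.I * n * α)

/-- The coefficients `λ_f(n) χ(n)` of the twist of `f` by a Dirichlet character. -/
def charTwistCoeff {k : ℕ} (f : CuspForm 𝒮ℒ (k : ℤ)) {N : ℕ} (χ : DirichletCharacter ℂ N)
    (n : ℕ) : ℂ :=
  lam f n * χ (n : ZMod N)

/-- `L(s, f)`. -/
def LFun {k : ℕ} (f : CuspForm 𝒮ℒ (k : ℤ)) (s : ℂ) : ℂ :=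
  continuedLSeries (lam f) s

/-- `L(s, f ⊗ e(α))`. -/
def LAdd {k : ℕ} (f : CuspForm 𝒮ℒ (k : ℤ)) (α : ℚ) (s : ℂ) : ℂ :=
  continuedLSeries (addTwistCoeff f α) s

/-- `L(s, f ⊗ χ)`. -/
def LChar {k : ℕ} (f : CuspForm 𝒮ℒ (k : ℤ)) {N : ℕ} (χ : DirichletCharacter ℂ N) (s : ℂ) : ℂ :=
  continuedLSeries (charTwistCoeff f χ) s

/-! ### The twisted moment -/

open Classical in
/-- The twisted first moment
`M_f(a, b; q) = φ(q)⁻¹ (∑*_{χ mod q} τ(χ) L(1/2, f ⊗ χ̄) χ(a) χ̄(b) + c_f(q) L(1/2, f))`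
with `c_f(q) = λ_f(q) q^(1/2) - 2`; the sum runs over the primitive characters modulo `q`,
`τ(χ) = ∑_{n mod q} χ(n) e(n/q)`, and `χ̄ = χ⁻¹`. -/
def twistedMoment {k : ℕ} (f : CuspForm 𝒮ℒ (k : ℤ)) (a b : ℤ) (q : ℕ) [NeZero q] : ℂ :=
  ((q.totient : ℂ))⁻¹ *
    ((∑ χ : DirichletCharacter ℂ q with χ.IsPrimitive,
        gaussSum χ ZMod.stdAddChar * LChar f χ⁻¹ (1 / 2) * χ (a : ZMod q) * χ⁻¹ (b : ZMod q)) +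
      (lam f q * (q : ℂ) ^ (1 / 2 : ℂ) - 2) * LFun f (1 / 2))

end HeckeReciprocity

end

/-! ### Cusp forms on the upper half plane: modularity, growth, Fourier expansion. -/

namespace HeckeReciprocity

open Complex Filter Topology

/-! Write k = 2m + 2. The twisted moment is a central value in disguise: orthogonality of the
characters mod q turns the sum over primitive χ into the additive character e(nu/q) with u = b/a mod
q, and the Hecke relation at q shows that the trivial character and the n divisible by q contribute
exactly the term with λ_f(q)√q - 2. Hence M_f(a,b;q) = L(1/2, f ⊗ e(u/q)) (`twistedMoment_eq_LAdd`),
and the claim becomes a relation among additive twists.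

Such a twist is a period: L(1/2 + j, f ⊗ e(α)) is a constant times the integral of f(α + it) t^(m+j)
over t > 0 (`LAdd_half_add`). Take cusps A = -p̄q/r and B = qt/p, with t inverse to r mod p, so that
B - A = q/(pr). The form f(z)((z - A)(z - B))^m dz has integral zero around the geodesic triangle A,
B, ∞ (`integral_triangle`). On the two vertical sides the binomial expansion gives the values at 1/2
+ j. The third side is moved to a vertical line by a matrix sending ∞ to B; there the form is a
constant times f(x + it) t^m dt, where x has denominator q, so it is a single central value. The
terms j = 0, with the functional equation at B (`vint_functional_equation`), are the other two
moments, and j ≥ 1 is the right-hand side (`LAdd_triangle`).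

For the bound, estimating each j separately would lose powers of pr/q. Put δ = B - A instead. On
each vertical side the kernel is compared with its leading term below height δ; above height δ the
two sides differ by a horizontal segment. Each error is O(δ^(m-1)), and division by δ^m leaves 1/δ =
pr/q (`exists_norm_vint_le`).

Absolute convergence for Re s > 1 needs only the mean square of the coefficients, from Bessel's
inequality at height 1/N. -/

/-- A function on `ℍ`, viewed as a function on `ℂ` (with junk values outside the half plane). -/
noncomputable def onPlane {k : ℕ} (f : CuspForm 𝒮ℒ (k : ℤ)) (z : ℂ) : ℂ :=
  f (UpperHalfPlane.ofComplex z)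

/-- The Fourier coefficients of a cusp form of level one. -/
noncomputable def coeff {k : ℕ} (f : CuspForm 𝒮ℒ (k : ℤ)) (n : ℕ) : ℂ :=
  (UpperHalfPlane.qExpansion 1 f).coeff n

section Basic

variable {k : ℕ} (f : CuspForm 𝒮ℒ (k : ℤ))

lemma onPlane_coe (z : ℍ) : onPlane f z = f z := by simp [onPlane]

lemma onPlane_of_im_pos {z : ℂ} (hz : 0 < z.im) : onPlane f z = f ⟨z, hz⟩ := by
  rw [onPlane, UpperHalfPlane.ofComplex_apply_of_im_pos hz]

lemma differentiableAt_onPlane {z : ℂ} (hz : 0 < z.im) : DifferentiableAt ℂ (onPlane f) z :=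
  UpperHalfPlane.mdifferentiableAt_iff.mp (ModularFormClass.holo f ⟨z, hz⟩)

lemma continuousOn_onPlane : ContinuousOn (onPlane f) {z : ℂ | 0 < z.im} :=
  fun _ hz => (differentiableAt_onPlane f hz).continuousAt.continuousWithinAt

lemma im_moebius {a b c d : ℝ} (hdet : a * d - b * c = 1) (z : ℂ) :
    ((a * z + b) / (c * z + d)).im = z.im / normSq (c * z + d) := by
  rw [div_im]
  simp only [add_im, mul_im, ofReal_im, ofReal_re, add_re, mul_re]
  rw [← sub_div]
  congr 1
  linear_combination z.im * hdet

lemma denom_ne_zero {a b c d : ℝ} (hdet : a * d - b * c = 1) {z : ℂ} (hz : 0 < z.im) :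
    (c * z + d : ℂ) ≠ 0 := by
  intro h
  have h1 := congrArg Complex.im h
  have h2 := congrArg Complex.re h
  simp at h1 h2
  rcases h1 with h1 | h1
  · simp [h1] at h2
    simp [h1, h2] at hdet
  · exact hz.ne' h1

lemma im_moebius_pos {a b c d : ℝ} (hdet : a * d - b * c = 1) {z : ℂ} (hz : 0 < z.im) :
    0 < ((a * z + b) / (c * z + d)).im := by
  rw [im_moebius hdet]
  exact div_pos hz (normSq_pos.mpr (denom_ne_zero hdet hz))

lemma onPlane_moebius {a b c d : ℤ} (hdet : a * d - b * c = 1) {z : ℂ} (hz : 0 < z.im) :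
    onPlane f ((a * z + b) / (c * z + d)) = (c * z + d) ^ k * onPlane f z := by
  let γ : SL(2, ℤ) := ⟨!![a, b; c, d], by rw [Matrix.det_fin_two_of]; exact hdet⟩
  have hpos : 0 < ((a * z + b) / (c * z + d)).im := by
    have := im_moebius_pos (a := a) (b := b) (c := c) (d := d) (by exact_mod_cast hdet) hz
    simpa using this
  have h := SlashInvariantForm.slash_action_eqn' (Γ := 𝒮ℒ) f
    (γ := (γ : GL (Fin 2) ℝ)) ⟨γ, rfl⟩ ⟨z, hz⟩
  rw [onPlane_of_im_pos f hpos, onPlane_of_im_pos f hz]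
  have e : (γ : GL (Fin 2) ℝ) • (⟨z, hz⟩ : ℍ) = ⟨(a * z + b) / (c * z + d), hpos⟩ := by
    ext
    exact (UpperHalfPlane.coe_specialLinearGroup_apply γ ⟨z, hz⟩).trans (by simp [γ])
  rw [e] at h
  refine h.trans ?_
  rw [zpow_natCast]
  congr 2

/-- At bounded height the invariant bound |f| ≤ C y^(-k/2) suffices, as the surplus power y^(n-k/2)
is bounded there; at large height exponential decay absorbs every power of y. -/
lemma exists_pow_im_mul_norm_le {n : ℕ} (hn : k ≤ 2 * n) :
    ∃ C, 0 ≤ C ∧ ∀ z : ℂ, 0 < z.im → z.im ^ n * ‖onPlane f z‖ ≤ C := by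
  obtain ⟨C₁, hC₁⟩ := CuspFormClass.exists_bound f
  have hd := CuspFormClass.exp_decay_atImInfty (h := 1) f one_pos (by simp)
  obtain ⟨K, hK⟩ := hd.bound
  obtain ⟨R, hR⟩ := (UpperHalfPlane.atImInfty_mem _).mp hK
  have hn' : (0 : ℝ) ≤ n - k / 2 := by
    have : (k : ℝ) ≤ 2 * n := by exact_mod_cast hn
    linarith
  refine ⟨max (|K| * n.factorial) ((max R 1) ^ ((n : ℝ) - k / 2) * |C₁|),
    le_max_of_le_left (by positivity), fun z hz => ?_⟩
  rw [onPlane_of_im_pos f hz]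
  rcases le_or_gt (max R 1) z.im with h | h
  · refine le_max_of_le_left ?_
    have h1 := hR ⟨z, hz⟩ ((le_max_left _ _).trans h)
    simp only [Set.mem_ofPred_eq, div_one, Real.norm_eq_abs, Real.abs_exp] at h1
    have h2 := Real.pow_div_factorial_le_exp z.im hz.le n
    rw [div_le_iff₀ (by positivity)] at h2
    have h3 : Real.exp (-2 * Real.pi * z.im) ≤ Real.exp (-z.im) :=
      Real.exp_le_exp.mpr (by nlinarith [Real.pi_gt_three])
    calc z.im ^ n * ‖f ⟨z, hz⟩‖
        ≤ (Real.exp z.im * n.factorial) * (|K| * Real.exp (-z.im)) := by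
          gcongr
          exact h1.trans (mul_le_mul (le_abs_self K) h3 (by positivity) (by positivity))
      _ = (Real.exp z.im * Real.exp (-z.im)) * (|K| * n.factorial) := by ring
      _ = |K| * n.factorial := by rw [← Real.exp_add]; simp
  · refine le_max_of_le_right ?_
    have h1 : ‖f ⟨z, hz⟩‖ ≤ C₁ / z.im ^ ((k : ℝ) / 2) := by simpa using hC₁ ⟨z, hz⟩
    rw [le_div_iff₀ (by positivity)] at h1
    calc z.im ^ n * ‖f ⟨z, hz⟩‖
        = z.im ^ ((n : ℝ) - k / 2) * (‖f ⟨z, hz⟩‖ * z.im ^ ((k : ℝ) / 2)) := by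
          rw [mul_comm ‖_‖, ← mul_assoc, ← Real.rpow_add hz, sub_add_cancel, Real.rpow_natCast]
      _ ≤ (max R 1) ^ ((n : ℝ) - k / 2) * |C₁| := by
          gcongr
          exact h1.trans (le_abs_self _)

lemma hasSum_onPlane {z : ℂ} (hz : 0 < z.im) :
    HasSum (fun n : ℕ => coeff f n * exp (2 * Real.pi * I * z) ^ n) (onPlane f z) := by
  have h := ModularForm.hasSum_qExpansion (h := 1) f one_pos (by simp) ⟨z, hz⟩
  rw [onPlane_of_im_pos f hz]
  simpa [coeff, Function.Periodic.qParam] using h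

lemma coeff_zero : coeff f 0 = 0 :=
  CuspFormClass.qExpansion_coeff_zero f one_pos (by simp)

lemma coeff_unique {c : ℕ → ℂ} (g : CuspForm 𝒮ℒ (k : ℤ))
    (h : ∀ z : ℂ, 0 < z.im → HasSum (fun n => c n * exp (2 * Real.pi * I * z) ^ n) (onPlane g z))
    (n : ℕ) : c n = coeff g n := by
  refine ModularFormClass.qExpansion_coeff_unique (Γ := 𝒮ℒ) (k := k) (h := 1) one_pos (by simp)
    (fun τ => ?_) n
  simpa [Function.Periodic.qParam, onPlane_coe] using h τ τ.im_pos

/-- The matrix -1 acts trivially on the half plane but multiplies f by (-1)^k. -/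
lemma even_weight (hf : f ≠ 0) : Even k := by
  by_contra h
  rw [Nat.not_even_iff_odd] at h
  refine hf (DFunLike.ext _ _ fun z => ?_)
  have h1 := onPlane_moebius f (a := -1) (b := 0) (c := 0) (d := -1) (by norm_num) z.im_pos
  simp only [Int.cast_neg, Int.cast_one, Int.cast_zero, zero_mul, zero_add, add_zero, h.neg_one_pow,
    neg_mul, one_mul, neg_div_neg_eq, div_one, onPlane_coe] at h1
  simpa using self_eq_neg.mp h1

end Basic

end HeckeReciprocity

/-! ### Decay and Mellin transforms on vertical lines above rational points. -/

namespace HeckeReciprocity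

open Complex Filter Topology Asymptotics

section Vertical

variable {k : ℕ} (f : CuspForm 𝒮ℒ (k : ℤ))

/-- A Möbius transformation maps the vertical line above its pole to the one above the image
of infinity. -/
lemma moebius_above_pole {a b c d : ℝ} (hdet : a * d - b * c = 1) (hc : c ≠ 0) {s : ℝ}
    (hs : s ≠ 0) :
    (a * ((-d / c : ℝ) + s * I) + b : ℂ) / (c * ((-d / c : ℝ) + s * I) + d) =
      (a / c : ℝ) + ((c ^ 2 * s)⁻¹ : ℝ) * I := by
  have hc' : (c : ℂ) ≠ 0 := by exact_mod_cast hc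
  have hs' : (s : ℂ) ≠ 0 := by exact_mod_cast hs
  have hdet' : (a * d - b * c : ℂ) = 1 := by exact_mod_cast hdet
  have e : (c * ((-d / c : ℝ) + s * I) + d : ℂ) = c * s * I := by
    push_cast
    field_simp
    ring
  rw [e, div_eq_iff (by simp [hc', hs'])]
  push_cast
  field_simp
  linear_combination -hdet' - I_sq

/-- Modularity restricted to vertical lines: the heights s above -d/c and 1/(c²s) above a/c
correspond. Both the decay at the real axis and the functional equation come from this. -/
lemma onPlane_above_pole {a b c d : ℤ} (hdet : a * d - b * c = 1) (hc : c ≠ 0) {s : ℝ}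
    (hs : 0 < s) :
    onPlane f ((a / c : ℝ) + (((c : ℝ) ^ 2 * s)⁻¹ : ℝ) * I) =
      (c * s * I) ^ k * onPlane f ((-d / c : ℝ) + s * I) := by
  have hc' : (c : ℂ) ≠ 0 := by exact_mod_cast hc
  have h := onPlane_moebius f hdet (z := (-d / c : ℝ) + s * I) (by simpa using hs)
  have h2 := moebius_above_pole (a := a) (b := b) (c := c) (d := d) (by exact_mod_cast hdet)
    (by exact_mod_cast hc) hs.ne'
  rw [← h2]
  simp only [ofReal_intCast]
  rw [h]
  congr 2
  push_cast
  field_simp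
  ring

lemma exists_det_eq_one (α : ℚ) : ∃ b d : ℤ, α.num * d - b * α.den = 1 := by
  have h : IsCoprime α.num (α.den : ℤ) := by
    rw [Int.isCoprime_iff_nat_coprime]
    simpa using α.reduced
  obtain ⟨u, v, huv⟩ := h
  exact ⟨-v, u, by linear_combination huv⟩

/-- On a vertical line above a cusp, a cusp form is smaller than every power of the height. -/
lemma norm_onPlane_vertical_le (α : ℚ) (n : ℤ) (hk : Even k) :
    ∃ C, 0 ≤ C ∧ ∀ y : ℝ, 0 < y → ‖onPlane f (α + y * I)‖ ≤ C * y ^ n := by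
  obtain ⟨l, rfl⟩ := hk
  -- For n ≤ -k/2 the global bound with exponent N = -n is enough. Otherwise the line is transported
  -- to height s = 1/(c²y) above another cusp, and N = n + k ≥ k/2 is used there.
  rcases le_total n (-(l : ℤ)) with hn | hn
  · obtain ⟨N, hN⟩ := Int.eq_ofNat_of_zero_le (show 0 ≤ -n by omega)
    obtain ⟨C, hC0, hC⟩ := exists_pow_im_mul_norm_le f (n := N) (by omega)
    refine ⟨C, hC0, fun y hy => ?_⟩
    have h := hC (α + y * I) (by simpa using hy)
    have e : n = -(N : ℤ) := by omega
    rw [e, zpow_neg, zpow_natCast, ← div_eq_mul_inv, le_div_iff₀ (by positivity), mul_comm]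
    simpa using h
  · obtain ⟨N, hN⟩ := Int.eq_ofNat_of_zero_le (show 0 ≤ n + (l + l : ℕ) by omega)
    obtain ⟨C, hC0, hC⟩ := exists_pow_im_mul_norm_le f (n := N) (by omega)
    obtain ⟨b, d, hdet⟩ := exists_det_eq_one α
    have hc : (0 : ℝ) < α.den := by exact_mod_cast α.den_pos
    refine ⟨C * (α.den : ℝ) ^ (l + l) * (α.den ^ 2 : ℝ) ^ n, by positivity, fun y hy => ?_⟩
    set s : ℝ := ((α.den : ℝ) ^ 2 * y)⁻¹ with hs
    have hs0 : 0 < s := by positivity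
    have hy' : y = ((α.den : ℝ) ^ 2 * s)⁻¹ := by rw [hs]; field_simp
    have h := onPlane_above_pole f hdet (by exact_mod_cast α.den_pos.ne') hs0
    simp only [Int.cast_natCast] at h
    rw [← hy'] at h
    have e : ((α.num / α.den : ℝ) : ℂ) = α := by
      push_cast
      exact_mod_cast congrArg (Rat.cast : ℚ → ℂ) (Rat.num_div_den α)
    rw [e] at h
    rw [h, norm_mul, norm_pow]
    have h2 := hC ((-d / α.den : ℝ) + s * I) (by simpa using hs0)
    simp only [add_im, ofReal_im, mul_im, ofReal_re, I_im, mul_one, I_re, mul_zero, add_zero,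
      zero_add] at h2
    have e1 : ‖((α.den : ℂ)) * s * I‖ = α.den * s := by
      simp [abs_of_pos hs0]
    rw [e1]
    have e2 : y ^ n * (α.den ^ 2 : ℝ) ^ n = s ^ (l + l) * (s ^ N)⁻¹ := by
      rw [← mul_zpow, mul_comm y, show (α.den : ℝ) ^ 2 * y = s⁻¹ by rw [hs, inv_inv], inv_zpow',
        ← zpow_natCast, ← zpow_natCast, ← zpow_neg, ← zpow_add₀ hs0.ne']
      congr 1
      omega
    calc (α.den * s : ℝ) ^ (l + l) * ‖onPlane f ((-d / α.den : ℝ) + s * I)‖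
        = (α.den : ℝ) ^ (l + l) * (s ^ (l + l) * (s ^ N)⁻¹) *
          (s ^ N * ‖onPlane f ((-d / α.den : ℝ) + s * I)‖) := by
          rw [mul_pow]
          field_simp
      _ ≤ (α.den : ℝ) ^ (l + l) * (s ^ (l + l) * (s ^ N)⁻¹) * C := by gcongr
      _ = _ := by rw [← e2]; ring

lemma continuousOn_vertical (α : ℝ) :
    ContinuousOn (fun t : ℝ => onPlane f (α + t * I)) (Set.Ioi 0) :=
  (continuousOn_onPlane f).comp (by fun_prop) fun t ht => by simpa using ht

lemma vertical_isBigO_atTop (α : ℚ) (hk : Even k) (n : ℤ) :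
    (fun t : ℝ => onPlane f (α + t * I)) =O[atTop] fun t => t ^ (-(n : ℝ)) := by
  obtain ⟨C, _, hC⟩ := norm_onPlane_vertical_le f α (-n) hk
  refine IsBigO.of_bound C ?_
  filter_upwards [eventually_gt_atTop 0] with t ht
  have e : t ^ (-(n : ℝ)) = t ^ (-n) := by exact_mod_cast Real.rpow_intCast t (-n)
  rw [e, Real.norm_of_nonneg (by positivity)]
  exact hC t ht

lemma vertical_isBigO_zero (α : ℚ) (hk : Even k) (n : ℤ) :
    (fun t : ℝ => onPlane f (α + t * I)) =O[𝓝[>] 0] fun t => t ^ (-(n : ℝ)) := by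
  obtain ⟨C, _, hC⟩ := norm_onPlane_vertical_le f α (-n) hk
  refine IsBigO.of_bound C ?_
  filter_upwards [self_mem_nhdsWithin] with t ht
  have ht' : 0 < t := ht
  have e : t ^ (-(n : ℝ)) = t ^ (-n) := by exact_mod_cast Real.rpow_intCast t (-n)
  rw [e, Real.norm_of_nonneg (by positivity)]
  exact hC t ht

lemma mellinConvergent_vertical (α : ℚ) (hk : Even k) (s : ℂ) :
    MellinConvergent (fun t : ℝ => onPlane f (α + t * I)) s := by
  refine mellinConvergent_of_isBigO_rpow
    ((continuousOn_vertical f α).locallyIntegrableOn measurableSet_Ioi)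
    (vertical_isBigO_atTop f α hk (⌈s.re⌉ + 1)) ?_ (vertical_isBigO_zero f α hk (⌊s.re⌋ - 1)) ?_
  · push_cast; linarith [Int.le_ceil s.re]
  · push_cast; linarith [Int.floor_le s.re]

/-- Decay faster than every power at both ends leaves no pole; this is the source of the entire
continuations. -/
lemma differentiable_mellin_vertical (α : ℚ) (hk : Even k) :
    Differentiable ℂ (mellin fun t : ℝ => onPlane f (α + t * I)) := by
  intro s
  refine mellin_differentiableAt_of_isBigO_rpow
    ((continuousOn_vertical f α).locallyIntegrableOn measurableSet_Ioi)
    (vertical_isBigO_atTop f α hk (⌈s.re⌉ + 1)) ?_ (vertical_isBigO_zero f α hk (⌊s.re⌋ - 1)) ?_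
  · push_cast; linarith [Int.le_ceil s.re]
  · push_cast; linarith [Int.floor_le s.re]

lemma hasSum_vertical (α : ℝ) {t : ℝ} (ht : 0 < t) :
    HasSum (fun n : ℕ => coeff f n * exp (2 * Real.pi * I * n * α) *
      (Real.exp (-(2 * Real.pi * n) * t) : ℝ)) (onPlane f (α + t * I)) := by
  convert hasSum_onPlane f (z := α + t * I) (by simpa using ht) using 2 with n
  rw [mul_assoc, ← exp_nat_mul, ofReal_exp, ← Complex.exp_add]
  congr 2
  push_cast
  linear_combination (-2 * Real.pi * n * t : ℂ) * I_sq

end Vertical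

end HeckeReciprocity

/-! ### Bessel's inequality and the mean square of the Fourier coefficients. -/

namespace HeckeReciprocity

open Complex Filter Topology Asymptotics

/-- Bessel's inequality for an absolutely convergent Fourier series with nonnegative
frequencies. -/
lemma sum_norm_sq_le_of_hasSum_exp {c : ℕ → ℂ} (hc : Summable fun n => ‖c n‖) {g : ℝ → ℂ} {B : ℝ}
    (hB : 0 ≤ B) (hg : ∀ x : ℝ, HasSum (fun n : ℕ => c n * exp (2 * Real.pi * I * n * x)) (g x))
    (hgB : ∀ x, ‖g x‖ ≤ B) (s : Finset ℕ) : ∑ n ∈ s, ‖c n‖ ^ 2 ≤ B ^ 2 := by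
  have : Fact ((0 : ℝ) < 1) := ⟨one_pos⟩
  have hsum : Summable fun n : ℕ => c n • (fourier (n : ℤ) : C(AddCircle (1 : ℝ), ℂ)) := by
    refine Summable.of_norm ?_
    simpa [norm_smul, fourier_norm] using hc
  obtain ⟨G, hG⟩ := hsum
  have hGB : ‖G‖ ≤ B := by
    refine (ContinuousMap.norm_le _ hB).mpr fun x => ?_
    induction x using QuotientAddGroup.induction_on with
    | H x =>
      have h1 := (ContinuousMap.evalCLM ℂ (x : AddCircle (1 : ℝ))).hasSum hG
      have h2 : G (x : AddCircle (1 : ℝ)) = g x := by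
        refine HasSum.unique (f := fun n : ℕ => c n * exp (2 * Real.pi * I * n * x)) ?_ (hg x)
        refine (h1 : HasSum _ (G (x : AddCircle (1 : ℝ)))).congr_fun fun n => ?_
        have h3 := fourier_coe_apply (T := 1) (n := n) (x := x)
        simp only [ofReal_one, div_one, Int.cast_natCast] at h3
        change _ = c n * fourier (n : ℤ) (x : AddCircle (1 : ℝ))
        rw [h3]
      rw [h2]
      exact hgB x
  -- In L² of the circle with its probability measure the characters are orthonormal, and the L²
  -- norm is at most the supremum norm.
  let T := ContinuousMap.toLp (E := ℂ) 2 (AddCircle.haarAddCircle (T := (1 : ℝ))) ℂ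
  have hTG : HasSum (fun n : ℕ => c n • fourierLp (T := 1) 2 (n : ℤ)) (T G) := by
    have := T.hasSum hG
    simpa [Function.comp_def, T, fourierLp] using this
  have hn : ‖T G‖ ≤ B := by
    have h1 := ContinuousMap.toLp_norm_le (E := ℂ) (p := 2) (𝕜 := ℂ)
      (AddCircle.haarAddCircle (T := (1 : ℝ)))
    have h2 : ‖T‖ ≤ 1 := by
      refine h1.trans ?_
      simp [MeasureTheory.measureUnivNNReal]
    exact (T.le_opNorm G).trans (by nlinarith [norm_nonneg G])
  have horth := (orthonormal_fourier (T := 1)).comp (fun n : ℕ => (n : ℤ)) Nat.cast_injective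
  have hcoef (n : ℕ) : inner ℂ (fourierLp (T := 1) 2 (n : ℤ)) (T G) = c n := by
    have h1 := (innerSL ℂ (fourierLp (T := 1) 2 (n : ℤ))).hasSum hTG
    refine h1.unique ?_
    refine (hasSum_ite_eq n (c n)).congr_fun fun m => ?_
    have h2 := orthonormal_iff_ite.mp horth n m
    simp only [Function.comp_apply] at h2
    rw [innerSL_apply_apply, inner_smul_right, h2]
    by_cases h : m = n
    · simp [h]
    · simp [h, Ne.symm h]
  calc ∑ n ∈ s, ‖c n‖ ^ 2
      = ∑ n ∈ s, ‖inner ℂ (fourierLp (T := 1) 2 (n : ℤ)) (T G)‖ ^ 2 := by simp only [hcoef]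
    _ ≤ ‖T G‖ ^ 2 := horth.sum_inner_products_le (T G)
    _ ≤ B ^ 2 := by gcongr

section Bounds

variable {k : ℕ} (f : CuspForm 𝒮ℒ (k : ℤ))

/-- The mean square of the Fourier coefficients. -/
lemma exists_sum_norm_sq_coeff_le (hk : Even k) :
    ∃ C, 0 ≤ C ∧ ∀ N : ℕ, ∑ n ∈ Finset.Icc 1 N, ‖coeff f n‖ ^ 2 ≤ C * (N : ℝ) ^ k := by
  obtain ⟨l, rfl⟩ := hk
  obtain ⟨C, hC0, hC⟩ := exists_pow_im_mul_norm_le f (n := l) (by omega)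
  refine ⟨C ^ 2 * Real.exp (4 * Real.pi), by positivity, fun N => ?_⟩
  rcases N.eq_zero_or_pos with rfl | hN
  · simp; positivity
  have hN' : (0 : ℝ) < N := by exact_mod_cast hN
  have hy : (0 : ℝ) < (N : ℝ)⁻¹ := by positivity
  -- At height 1/N the weights e^(-2πny) with n ≤ N are at least e^(-2π), while f is O(N^(k/2)).
  set y : ℝ := (N : ℝ)⁻¹
  have key := sum_norm_sq_le_of_hasSum_exp
    (c := fun n => coeff f n * (Real.exp (-(2 * Real.pi * n) * y) : ℝ))
    (g := fun x => onPlane f (x + y * I)) (B := C * (N : ℝ) ^ l) ?_ (by positivity) ?_ ?_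
    (Finset.Icc 1 N)
  · have h1 : ∀ n ∈ Finset.Icc 1 N, ‖coeff f n‖ ^ 2 * Real.exp (-(4 * Real.pi)) ≤
        ‖coeff f n * (Real.exp (-(2 * Real.pi * n) * y) : ℝ)‖ ^ 2 := by
      intro n hn
      rw [norm_mul, norm_real, Real.norm_eq_abs, Real.abs_exp, mul_pow, ← Real.exp_nat_mul]
      gcongr
      have : (n : ℝ) * y ≤ 1 := by
        rw [← div_eq_mul_inv, div_le_one hN']
        exact_mod_cast (Finset.mem_Icc.mp hn).2
      push_cast
      nlinarith [Real.pi_pos]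
    have h2 := (Finset.sum_le_sum h1).trans key
    rw [← Finset.sum_mul, Real.exp_neg, ← div_eq_mul_inv, div_le_iff₀ (Real.exp_pos _)] at h2
    refine h2.trans (le_of_eq ?_)
    ring
  · have := (hasSum_vertical f 0 hy).summable.norm
    simpa using this
  · intro x
    convert hasSum_vertical f x hy using 2 with n
    ring
  · intro x
    have h := hC (x + y * I) (by simpa using hy)
    simp only [add_im, ofReal_im, mul_im, ofReal_re, I_im, mul_one, I_re, mul_zero, add_zero,
      zero_add] at h
    have e : y ^ l = ((N : ℝ) ^ l)⁻¹ := by simp [y]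
    rwa [e, mul_comm, ← div_eq_mul_inv, div_le_iff₀ (by positivity)] at h

/-- By Cauchy–Schwarz the mean square gives partial sums O(N^((k+1)/2)). After division by
n^((k-1)/2) this is absolute convergence for Re s > 1, with no need for Deligne's bound. -/
lemma summable_coeff (hk : Even k) {σ : ℝ} (hσ : ((k : ℝ) + 1) / 2 < σ) :
    Summable fun n : ℕ => ‖coeff f n‖ / (n : ℝ) ^ σ := by
  obtain ⟨C, hC0, hC⟩ := exists_sum_norm_sq_coeff_le f hk
  have h := LSeriesSummable_of_sum_norm_bigO (f := coeff f) (r := ((k : ℝ) + 1) / 2) (s := σ)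
    (IsBigO.of_bound (Real.sqrt C) (Eventually.of_forall fun N => ?_)) (by positivity)
    (by simpa using hσ)
  · refine h.norm.congr fun n => ?_
    rcases n.eq_zero_or_pos with rfl | hn
    · simp [coeff_zero]
    · rw [LSeries.term_of_ne_zero hn.ne', norm_div, ← ofReal_natCast,
        norm_cpow_eq_rpow_re_of_pos (by exact_mod_cast hn), ofReal_re]
  · have h0 : 0 ≤ ∑ n ∈ Finset.Icc 1 N, ‖coeff f n‖ := Finset.sum_nonneg fun _ _ => norm_nonneg _
    rw [Real.norm_of_nonneg h0, Real.norm_of_nonneg (by positivity)]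
    have h1 := sq_sum_le_card_mul_sum_sq (s := Finset.Icc 1 N) (f := fun n => ‖coeff f n‖)
    have h2 : (∑ n ∈ Finset.Icc 1 N, ‖coeff f n‖) ^ 2 ≤ N * (C * (N : ℝ) ^ k) :=
      h1.trans (by simpa using mul_le_mul_of_nonneg_left (hC N) (Nat.cast_nonneg N))
    refine (Real.le_sqrt h0 (by positivity)).mpr h2 |>.trans (le_of_eq ?_)
    rw [show N * (C * (N : ℝ) ^ k) = C * (N : ℝ) ^ (k + 1) by ring, Real.sqrt_mul hC0,
      Real.sqrt_eq_rpow ((N : ℝ) ^ (k + 1)), ← Real.rpow_natCast, ← Real.rpow_mul (by positivity)]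
    congr 2
    push_cast
    ring

end Bounds

end HeckeReciprocity

/-! ### Hecke operators on Fourier coefficients and the normalized eigenvalues. -/

namespace HeckeReciprocity

open Complex Filter Topology

section Hecke

variable {k : ℕ} (f : CuspForm 𝒮ℒ (k : ℤ))

lemma sum_range_exp (d l : ℕ) (hd : d ≠ 0) :
    ∑ b ∈ Finset.range d, exp (2 * Real.pi * I * (b / d)) ^ l = if d ∣ l then (d : ℂ) else 0 := by
  have hζ := Complex.isPrimitiveRoot_exp d hd
  have e (b : ℕ) : exp (2 * Real.pi * I * (b / d)) ^ l = (exp (2 * Real.pi * I / d) ^ l) ^ b := by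
    rw [← exp_nat_mul, ← exp_nat_mul, ← exp_nat_mul]
    congr 1
    ring
  simp only [e]
  split_ifs with h
  · rw [(hζ.pow_eq_one_iff_dvd l).mpr h]
    simp
  · have h1 : exp (2 * Real.pi * I / d) ^ l ≠ 1 := fun h' => h ((hζ.pow_eq_one_iff_dvd l).mp h')
    have h2 := mul_neg_geom_sum (exp (2 * Real.pi * I / d) ^ l) d
    rw [← pow_mul, mul_comm l d, pow_mul, hζ.pow_eq_one, one_pow, sub_self] at h2
    exact (mul_eq_zero.mp h2).resolve_left (sub_ne_zero.mpr h1.symm)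

/-- Summing over b mod d keeps only the exponents l = dl', each with weight d, and the substitution
z ↦ ez/d turns the exponent dl' into el'. -/
lemma hasSum_hecke_block {d e : ℕ} (hd : d ≠ 0) (he : e ≠ 0) {z : ℂ} (hz : 0 < z.im) :
    HasSum (fun m : ℕ => (if e ∣ m then d * coeff f (d * (m / e)) else 0) *
        exp (2 * Real.pi * I * z) ^ m)
      (∑ b ∈ Finset.range d, onPlane f ((e * z + b) / d)) := by
  have hd' : (d : ℂ) ≠ 0 := by exact_mod_cast hd
  have hdpos : (0 : ℝ) < d := by exact_mod_cast Nat.pos_of_ne_zero hd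
  have hepos : (0 : ℝ) < e := by exact_mod_cast Nat.pos_of_ne_zero he
  have h1 : HasSum (fun l : ℕ => ∑ b ∈ Finset.range d,
      coeff f l * exp (2 * Real.pi * I * ((e * z + b) / d)) ^ l)
      (∑ b ∈ Finset.range d, onPlane f ((e * z + b) / d)) := by
    refine hasSum_sum fun b _ => hasSum_onPlane f ?_
    rw [show ((e * z + b) / d : ℂ) = ((e / d : ℝ) : ℂ) * z + ((b / d : ℝ) : ℂ) by
      push_cast; field_simp]
    simp only [add_im, mul_im, ofReal_re, ofReal_im, zero_mul, add_zero]
    positivity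
  have h2 : HasSum (fun l : ℕ => if d ∣ l then
      d * coeff f l * exp (2 * Real.pi * I * (e * z / d)) ^ l else 0)
      (∑ b ∈ Finset.range d, onPlane f ((e * z + b) / d)) := by
    refine h1.congr_fun fun l => ?_
    have e1 (b : ℕ) : coeff f l * exp (2 * Real.pi * I * ((e * z + b) / d)) ^ l =
        coeff f l * exp (2 * Real.pi * I * (e * z / d)) ^ l *
          exp (2 * Real.pi * I * (b / d)) ^ l := by
      rw [mul_assoc (coeff f l), ← mul_pow, ← Complex.exp_add]
      congr 3
      ring
    simp only [e1]
    rw [← Finset.mul_sum, sum_range_exp d l hd]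
    split_ifs
    · ring
    · simp
  have hinj (a : ℕ) (ha : a ≠ 0) : Function.Injective fun l : ℕ => a * l :=
    fun x y h => Nat.eq_of_mul_eq_mul_left (Nat.pos_of_ne_zero ha) h
  rw [← (hinj d hd).hasSum_iff] at h2
  · rw [← (hinj e he).hasSum_iff]
    · refine h2.congr_fun fun l => ?_
      simp only [Function.comp_apply, dvd_mul_right, if_true,
        Nat.mul_div_cancel_left l (Nat.pos_of_ne_zero he)]
      rw [← exp_nat_mul, ← exp_nat_mul]
      congr 2
      push_cast
      field_simp
    · intro m hm
      rw [if_neg, zero_mul]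
      rintro ⟨l, rfl⟩
      exact hm ⟨l, rfl⟩
  · intro m hm
    rw [if_neg]
    rintro ⟨l, rfl⟩
    exact hm ⟨l, rfl⟩

lemma hasSum_heckeOperator {n : ℕ} (hn : n ≠ 0) (z : ℍ) :
    HasSum (fun m : ℕ => (n : ℂ) ^ ((k : ℤ) - 1) * (∑ d ∈ n.divisors, ((d : ℂ) ^ k)⁻¹ *
        (if n / d ∣ m then d * coeff f (d * (m / (n / d))) else 0)) *
        exp (2 * Real.pi * I * z) ^ m)
      (heckeOperator k n f z) := by
  have h : HasSum (fun m : ℕ => ∑ d ∈ n.divisors, ((d : ℂ) ^ k)⁻¹ *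
        ((if n / d ∣ m then d * coeff f (d * (m / (n / d))) else 0) *
          exp (2 * Real.pi * I * z) ^ m))
      (∑ d ∈ n.divisors, ((d : ℂ) ^ k)⁻¹ *
        ∑ b ∈ Finset.range d, onPlane f (((n / d : ℕ) * z + b) / d)) := by
    refine hasSum_sum fun d hd => HasSum.mul_left _ ?_
    have hdn := Nat.dvd_of_mem_divisors hd
    refine hasSum_hecke_block f (fun h => hn (by simpa [h] using hdn)) ?_ z.im_pos
    exact (Nat.div_pos (Nat.le_of_dvd (Nat.pos_of_ne_zero hn) hdn)
      (Nat.pos_of_mem_divisors hd)).ne'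
  have h2 := h.mul_left ((n : ℂ) ^ ((k : ℤ) - 1))
  simp only [heckeOperator]
  have e : (n : ℂ) ^ ((k : ℤ) - 1) * ∑ d ∈ n.divisors, ∑ b ∈ Finset.range d, ((d : ℂ) ^ k)⁻¹ *
      f (UpperHalfPlane.ofComplex ((((n / d : ℕ) : ℂ) * (z : ℂ) + b) / d)) =
      (n : ℂ) ^ ((k : ℤ) - 1) * ∑ d ∈ n.divisors, ((d : ℂ) ^ k)⁻¹ *
        ∑ b ∈ Finset.range d, onPlane f (((n / d : ℕ) * z + b) / d) := by
    simp only [Finset.mul_sum, onPlane]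
  rw [e]
  refine h2.congr_fun fun m => ?_
  rw [mul_assoc, Finset.sum_mul]
  simp only [mul_assoc]

variable {f}

lemma coeff_of_isHeckeEigenvalue {n : ℕ} (hn : n ≠ 0) {c : ℂ} (hc : IsHeckeEigenvalue f n c)
    (m : ℕ) :
    c * coeff f m = (n : ℂ) ^ ((k : ℤ) - 1) * ∑ d ∈ n.divisors, ((d : ℂ) ^ k)⁻¹ *
      (if n / d ∣ m then d * coeff f (d * (m / (n / d))) else 0) := by
  have h1 := coeff_unique (c := fun m => c * coeff f m) (c • f) (fun z hz => ?_) m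
  · have h2 := coeff_unique (c := fun m => (n : ℂ) ^ ((k : ℤ) - 1) * ∑ d ∈ n.divisors,
      ((d : ℂ) ^ k)⁻¹ * (if n / d ∣ m then d * coeff f (d * (m / (n / d))) else 0))
      (c • f) (fun z hz => ?_) m
    · exact h1.trans h2.symm
    · have h := hasSum_heckeOperator f hn ⟨z, hz⟩
      rw [hc ⟨z, hz⟩] at h
      rw [onPlane_of_im_pos _ hz]
      exact h
  · have h := (hasSum_onPlane f hz).mul_left c
    rw [onPlane_of_im_pos _ hz] at h ⊢
    exact h.congr_fun fun n => mul_assoc _ _ _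

/-- In the first coefficient of T_n f only the divisor d = n survives. -/
lemma coeff_eq_of_isHeckeEigenvalue {n : ℕ} (hn : n ≠ 0) {c : ℂ}
    (hc : IsHeckeEigenvalue f n c) : coeff f n = c * coeff f 1 := by
  rw [coeff_of_isHeckeEigenvalue hn hc 1, Finset.sum_eq_single_of_mem n (by simp [hn])]
  · have hn' : (n : ℂ) ≠ 0 := by exact_mod_cast hn
    rw [Nat.div_self (Nat.pos_of_ne_zero hn), if_pos (dvd_refl 1), Nat.div_self one_pos, mul_one,
      zpow_sub_one₀ hn', zpow_natCast]
    field_simp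
  · intro d hd hdn
    rw [if_neg, mul_zero]
    intro h
    have h1 : n / d = 1 := Nat.dvd_one.mp h
    have h2 := Nat.div_mul_cancel (Nat.dvd_of_mem_divisors hd)
    rw [h1, one_mul] at h2
    exact hdn h2

lemma coeff_mul_prime {p : ℕ} (hp : p.Prime) {c : ℂ} (hc : IsHeckeEigenvalue f p c) (m : ℕ) :
    c * coeff f m = coeff f (p * m) +
      (p : ℂ) ^ ((k : ℤ) - 1) * if p ∣ m then coeff f (m / p) else 0 := by
  have hp' : (p : ℂ) ≠ 0 := by exact_mod_cast hp.ne_zero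
  rw [coeff_of_isHeckeEigenvalue hp.ne_zero hc m, hp.sum_divisors]
  simp only [Nat.div_self hp.pos, one_dvd, if_true, Nat.div_one, Nat.cast_one, one_pow, inv_one,
    one_mul]
  rw [mul_add, zpow_sub_one₀ hp', zpow_natCast]
  congr 1
  field_simp

lemma coeff_one_ne_zero (hf : IsHeckeCuspForm f) : coeff f 1 ≠ 0 := by
  intro h1
  refine hf.1 (DFunLike.ext _ _ fun z => ?_)
  have h (n : ℕ) : coeff f n = 0 := by
    rcases eq_or_ne n 0 with rfl | hn
    · exact coeff_zero f
    · obtain ⟨c, hc⟩ := hf.2 n (Nat.pos_of_ne_zero hn)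
      rw [coeff_eq_of_isHeckeEigenvalue hn hc, h1, mul_zero]
  have h2 := hasSum_onPlane f z.im_pos
  simp only [h, zero_mul] at h2
  simpa [onPlane_coe] using h2.unique hasSum_zero

lemma exists_isHeckeEigenvalue_lam (hf : IsHeckeCuspForm f) {n : ℕ} (hn : n ≠ 0) :
    ∃ c, IsHeckeEigenvalue f n c ∧ lam f n = c / (n : ℂ) ^ (((k : ℂ) - 1) / 2) := by
  have h := hf.2 n (Nat.pos_of_ne_zero hn)
  exact ⟨h.choose, h.choose_spec, by rw [lam, dif_pos h]⟩

/-- The divisor sum defining T_0 is empty, so its only eigenvalue on a nonzero form is 0. -/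
lemma lam_zero (hf : IsHeckeCuspForm f) : lam f 0 = 0 := by
  rw [lam]
  split_ifs with h
  · obtain ⟨z, hz⟩ := DFunLike.ne_iff.mp hf.1
    have h1 := h.choose_spec z
    simp only [heckeOperator, Nat.divisors_zero, Finset.sum_empty, mul_zero] at h1
    rw [(mul_eq_zero.mp h1.symm).resolve_right hz, zero_div]
  · rfl

lemma lam_eq (hf : IsHeckeCuspForm f) (n : ℕ) :
    lam f n = coeff f n / (n : ℂ) ^ (((k : ℂ) - 1) / 2) / coeff f 1 := by
  rcases eq_or_ne n 0 with rfl | hn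
  · rw [lam_zero hf, coeff_zero, zero_div, zero_div]
  · obtain ⟨c, hc, h⟩ := exists_isHeckeEigenvalue_lam hf hn
    have := coeff_one_ne_zero hf
    rw [h, coeff_eq_of_isHeckeEigenvalue hn hc]
    field_simp

/-- This Hecke relation later isolates the terms of L(s, f) with q ∣ n, and so produces the
coefficient λ_f(q)√q - 2 of the moment. -/
lemma lam_mul_prime (hf : IsHeckeCuspForm f) {p : ℕ} (hp : p.Prime) (m : ℕ) :
    lam f p * lam f m = lam f (p * m) + if p ∣ m then lam f (m / p) else 0 := by
  obtain ⟨c, hc, h⟩ := exists_isHeckeEigenvalue_lam hf hp.ne_zero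
  have h1 := coeff_one_ne_zero hf
  have hp' : (p : ℂ) ≠ 0 := by exact_mod_cast hp.ne_zero
  rcases eq_or_ne m 0 with rfl | hm
  · simp [lam_zero hf]
  have key := coeff_mul_prime hp hc m
  have hpw : (p : ℂ) ^ (((k : ℂ) - 1) / 2) ≠ 0 := by simp [cpow_eq_zero_iff, hp']
  have hmw : (m : ℂ) ^ (((k : ℂ) - 1) / 2) ≠ 0 := by
    simp [cpow_eq_zero_iff, Nat.cast_ne_zero.mpr hm]
  have e : (p : ℂ) ^ ((k : ℤ) - 1) =
      (p : ℂ) ^ (((k : ℂ) - 1) / 2) * (p : ℂ) ^ (((k : ℂ) - 1) / 2) := by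
    rw [← cpow_add _ _ hp', add_halves, ← cpow_intCast]
    push_cast
    rfl
  have hmul : ((p * m : ℕ) : ℂ) ^ (((k : ℂ) - 1) / 2) =
      (p : ℂ) ^ (((k : ℂ) - 1) / 2) * (m : ℂ) ^ (((k : ℂ) - 1) / 2) := by
    rw [Nat.cast_mul, natCast_mul_natCast_cpow]
  rw [h, lam_eq hf m, lam_eq hf (p * m), hmul]
  have e2 : c / (p : ℂ) ^ (((k : ℂ) - 1) / 2) *
      (coeff f m / (m : ℂ) ^ (((k : ℂ) - 1) / 2) / coeff f 1) =
      (c * coeff f m) / ((p : ℂ) ^ (((k : ℂ) - 1) / 2) * (m : ℂ) ^ (((k : ℂ) - 1) / 2)) /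
        coeff f 1 := by
    field_simp
  rw [e2, key, add_div, add_div]
  congr 1
  split_ifs with hpm
  · obtain ⟨l, rfl⟩ := hpm
    rw [Nat.mul_div_cancel_left _ hp.pos, lam_eq hf l, e, Nat.cast_mul,
      natCast_mul_natCast_cpow]
    field_simp
  · simp

end Hecke

end HeckeReciprocity

/-! ### Calculus of continued Dirichlet series; additive and character twists. -/

namespace HeckeReciprocity

open Complex Filter Topology

section Continuation

lemma IsEntireContinuation.continuedLSeries_eq {a : ℕ → ℂ} {F : ℂ → ℂ}
    (hF : IsEntireContinuation a F) (s : ℂ) : continuedLSeries a s = F s := by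
  have h : ∃ F, IsEntireContinuation a F := ⟨F, hF⟩
  rw [continuedLSeries, dif_pos h, h.choose_spec.unique hF]

lemma isEntireContinuation_continuedLSeries {a : ℕ → ℂ} (h : ∃ F, IsEntireContinuation a F) :
    IsEntireContinuation a (continuedLSeries a) := by
  obtain ⟨F, hF⟩ := h
  rwa [show continuedLSeries a = F from funext hF.continuedLSeries_eq]

lemma IsEntireContinuation.congr {a b : ℕ → ℂ} {F : ℂ → ℂ} (hF : IsEntireContinuation a F)
    (h : ∀ n, n ≠ 0 → b n = a n) : IsEntireContinuation b F := by
  refine ⟨hF.1, fun s hs => HasSum.congr_fun (hF.2 s hs) fun n => ?_⟩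
  rcases eq_or_ne n 0 with rfl | hn
  · simp
  · rw [LSeries.term_of_ne_zero hn, LSeries.term_of_ne_zero hn, h n hn]

lemma IsEntireContinuation.mul_left {a : ℕ → ℂ} {F : ℂ → ℂ} (hF : IsEntireContinuation a F)
    (c : ℂ) : IsEntireContinuation (fun n => c * a n) fun s => c * F s := by
  refine ⟨hF.1.const_mul c, fun s hs => HasSum.congr_fun ((hF.2 s hs).mul_left c) fun n => ?_⟩
  rcases eq_or_ne n 0 with rfl | hn
  · simp
  · rw [LSeries.term_of_ne_zero hn, LSeries.term_of_ne_zero hn, mul_div_assoc]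

lemma IsEntireContinuation.add {a b : ℕ → ℂ} {F G : ℂ → ℂ} (hF : IsEntireContinuation a F)
    (hG : IsEntireContinuation b G) :
    IsEntireContinuation (fun n => a n + b n) fun s => F s + G s := by
  refine ⟨hF.1.add hG.1, fun s hs => HasSum.congr_fun ((hF.2 s hs).add (hG.2 s hs)) fun n => ?_⟩
  rcases eq_or_ne n 0 with rfl | hn
  · simp
  · simp only [LSeries.term_of_ne_zero hn, Pi.add_apply, add_div]

lemma IsEntireContinuation.sub {a b : ℕ → ℂ} {F G : ℂ → ℂ} (hF : IsEntireContinuation a F)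
    (hG : IsEntireContinuation b G) :
    IsEntireContinuation (fun n => a n - b n) fun s => F s - G s := by
  refine ⟨hF.1.sub hG.1, fun s hs => HasSum.congr_fun ((hF.2 s hs).sub (hG.2 s hs)) fun n => ?_⟩
  rcases eq_or_ne n 0 with rfl | hn
  · simp
  · simp only [LSeries.term_of_ne_zero hn, Pi.sub_apply, sub_div]

lemma IsEntireContinuation.sum {ι : Type*} (t : Finset ι) {a : ι → ℕ → ℂ} {F : ι → ℂ → ℂ}
    (h : ∀ i ∈ t, IsEntireContinuation (a i) (F i)) :
    IsEntireContinuation (fun n => ∑ i ∈ t, a i n) fun s => ∑ i ∈ t, F i s := by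
  refine ⟨by simpa using Differentiable.fun_sum fun i hi => (h i hi).1,
    fun s hs => HasSum.congr_fun (hasSum_sum fun i hi => (h i hi).2 s hs) fun n => ?_⟩
  rcases eq_or_ne n 0 with rfl | hn
  · simp
  · simp only [LSeries.term_of_ne_zero hn, Finset.sum_div]

/-- The Dirichlet series supported on multiples of `q`. -/
lemma IsEntireContinuation.dilate {a : ℕ → ℂ} {F : ℂ → ℂ} (hF : IsEntireContinuation a F)
    {q : ℕ} (hq : q ≠ 0) :
    IsEntireContinuation (fun n => if q ∣ n then a (n / q) else 0)
      fun s => (q : ℂ) ^ (-s) * F s := by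
  have hq' : (q : ℂ) ≠ 0 := by exact_mod_cast hq
  refine ⟨Differentiable.mul (fun s => ?_) hF.1, fun s hs => ?_⟩
  · exact (differentiableAt_id.neg).const_cpow (Or.inl hq')
  have hinj : Function.Injective fun l : ℕ => q * l :=
    fun x y h => Nat.eq_of_mul_eq_mul_left (Nat.pos_of_ne_zero hq) h
  rw [LSeriesHasSum, ← hinj.hasSum_iff]
  · refine HasSum.congr_fun ((hF.2 s hs).mul_left _) fun l => ?_
    rcases eq_or_ne l 0 with rfl | hl
    · simp
    · simp only [Function.comp_apply]
      rw [LSeries.term_of_ne_zero hl, LSeries.term_of_ne_zero (mul_ne_zero hq hl),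
        if_pos (dvd_mul_right q l), Nat.mul_div_cancel_left _ (Nat.pos_of_ne_zero hq),
        Nat.cast_mul, natCast_mul_natCast_cpow, cpow_neg]
      field_simp
  · intro n hn
    rcases eq_or_ne n 0 with rfl | hn0
    · simp
    · rw [LSeries.term_of_ne_zero hn0, if_neg, zero_div]
      rintro ⟨l, rfl⟩
      exact hn ⟨l, rfl⟩

end Continuation

section LFunctions

variable {k : ℕ} {f : CuspForm 𝒮ℒ (k : ℤ)}

/-- The integral representation of `L(s, f ⊗ e(α))`. -/
noncomputable def addIntegral (f : CuspForm 𝒮ℒ (k : ℤ)) (α : ℚ) (s : ℂ) : ℂ :=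
  (2 * Real.pi : ℂ) ^ (s + ((k : ℂ) - 1) / 2) * (Gamma (s + ((k : ℂ) - 1) / 2))⁻¹ *
    mellin (fun t : ℝ => onPlane f (α + t * I)) (s + ((k : ℂ) - 1) / 2) / coeff f 1

lemma even_of_isHeckeCuspForm (hf : IsHeckeCuspForm f) : Even k := even_weight f hf.1

/-- Termwise Mellin transformation of the Fourier expansion gives the Dirichlet series for Re s > 1;
the formula is entire because 1/Γ and the Mellin transform are. -/
lemma isEntireContinuation_addTwist (hf : IsHeckeCuspForm f) (α : ℚ) :
    IsEntireContinuation (addTwistCoeff f α) (addIntegral f α) := by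
  have hk := even_of_isHeckeCuspForm hf
  have h2pi : (2 * Real.pi : ℂ) ≠ 0 := by simp [Real.pi_ne_zero]
  refine ⟨?_, fun s hs => ?_⟩
  · have hw : Differentiable ℂ fun s : ℂ => s + ((k : ℂ) - 1) / 2 := by fun_prop
    refine (Differentiable.mul (Differentiable.mul ?_ ?_) ?_).div_const _
    · exact fun s => (hw s).const_cpow (Or.inl h2pi)
    · exact differentiable_one_div_Gamma.comp hw
    · exact (differentiable_mellin_vertical f α hk).comp hw
  -- The shift undoes the normalization of λ_f: Re s > 1 becomes Re w > (k+1)/2, the range of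
  -- `summable_coeff`.
  · set w := s + ((k : ℂ) - 1) / 2 with hwdef
    have hwre : w.re = s.re + ((k : ℝ) - 1) / 2 := by simp [hwdef]
    have hw1 : ((k : ℝ) + 1) / 2 < w.re := by rw [hwre]; linarith
    have hw0 : 0 < w.re := lt_of_le_of_lt (by positivity) hw1
    have hnorm (n : ℕ) : ‖exp (2 * Real.pi * I * n * (α : ℝ))‖ = 1 := by
      rw [show (2 * Real.pi * I * n * (α : ℝ) : ℂ) = ((2 * Real.pi * n * α : ℝ) : ℂ) * I by
        push_cast; ring, norm_exp_ofReal_mul_I]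
    have h := hasSum_mellin (a := fun n : ℕ => coeff f n * exp (2 * Real.pi * I * n * (α : ℝ)))
      (p := fun n : ℕ => 2 * Real.pi * n) (F := fun t : ℝ => onPlane f ((α : ℝ) + t * I))
      (s := w) (fun n => ?_) hw0 (fun t ht => hasSum_vertical f α ht) ?_
    · refine HasSum.congr_fun ((h.mul_left
        ((2 * Real.pi : ℂ) ^ w * (Gamma w)⁻¹)).div_const (coeff f 1)) fun n => ?_
      rcases eq_or_ne n 0 with rfl | hn
      · simp [coeff_zero]
      · have hG := Gamma_ne_zero_of_re_pos hw0
        have hn' : (n : ℂ) ≠ 0 := by exact_mod_cast hn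
        have hnw : (n : ℂ) ^ w ≠ 0 := by simp [cpow_eq_zero_iff, hn']
        have hpw : (2 * Real.pi : ℂ) ^ w ≠ 0 := by simp [cpow_eq_zero_iff, h2pi]
        have e1 : ((2 * Real.pi * n : ℝ) : ℂ) ^ w = (2 * Real.pi : ℂ) ^ w * (n : ℂ) ^ w := by
          rw [ofReal_mul, mul_cpow_ofReal_nonneg (by positivity) (by positivity)]
          simp
        have e2 : (n : ℂ) ^ w = (n : ℂ) ^ s * (n : ℂ) ^ (((k : ℂ) - 1) / 2) := by
          rw [hwdef, cpow_add _ _ hn']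
        rw [LSeries.term_of_ne_zero hn, addTwistCoeff, lam_eq hf, e1]
        rw [e2] at hnw ⊢
        have h3 := left_ne_zero_of_mul hnw
        have h4 := right_ne_zero_of_mul hnw
        simp only [ofReal_ratCast]
        field_simp
    · rcases eq_or_ne n 0 with rfl | hn
      · simp [coeff_zero]
      · right
        have : (0 : ℝ) < n := by exact_mod_cast Nat.pos_of_ne_zero hn
        positivity
    · have h1 := (summable_coeff f hk hw1).div_const ((2 * Real.pi) ^ w.re)
      refine h1.congr fun n => ?_
      rw [norm_mul, hnorm, mul_one, Real.mul_rpow (x := 2 * Real.pi) (by positivity)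
        (by positivity), div_div, mul_comm (_ ^ _)]

lemma LAdd_eq (hf : IsHeckeCuspForm f) (α : ℚ) (s : ℂ) : LAdd f α s = addIntegral f α s :=
  (isEntireContinuation_addTwist hf α).continuedLSeries_eq s

lemma isEntireContinuation_LAdd (hf : IsHeckeCuspForm f) (α : ℚ) :
    IsEntireContinuation (addTwistCoeff f α) (LAdd f α) :=
  isEntireContinuation_continuedLSeries ⟨_, isEntireContinuation_addTwist hf α⟩

lemma isEntireContinuation_LFun (hf : IsHeckeCuspForm f) :
    IsEntireContinuation (lam f) (LFun f) := by
  exact isEntireContinuation_continuedLSeries ⟨_,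
    (isEntireContinuation_addTwist hf 0).congr fun n _ => by simp [addTwistCoeff]⟩

lemma addTwistCoeff_intCast_div (j : ℤ) {N : ℕ} [NeZero N] (n : ℕ) :
    addTwistCoeff f (j / N) n = lam f n * ZMod.stdAddChar ((j : ZMod N) * (n : ZMod N)) := by
  have h := ZMod.stdAddChar_coe (N := N) (j * n)
  push_cast at h
  rw [h, addTwistCoeff]
  congr 2
  push_cast
  ring

/-- Twists with period `N` are linear combinations of additive twists. -/
lemma charTwistCoeff_eq_sum {N : ℕ} [NeZero N] (χ : DirichletCharacter ℂ N) (n : ℕ) :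
    charTwistCoeff f χ n = ∑ j : ZMod N, ((N : ℂ)⁻¹ * ZMod.dft (χ : ZMod N → ℂ) j) *
      addTwistCoeff f (((j.val : ℤ) : ℚ) / N) n := by
  have h := ZMod.invDFT_apply (ZMod.dft (χ : ZMod N → ℂ)) (n : ZMod N)
  rw [LinearEquiv.symm_apply_apply] at h
  rw [charTwistCoeff, h, smul_eq_mul, Finset.mul_sum, Finset.mul_sum]
  refine Finset.sum_congr rfl fun j _ => ?_
  rw [addTwistCoeff_intCast_div, Int.cast_natCast, ZMod.natCast_zmod_val, smul_eq_mul]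
  ring

lemma isEntireContinuation_LChar (hf : IsHeckeCuspForm f) {N : ℕ} [NeZero N]
    (χ : DirichletCharacter ℂ N) : IsEntireContinuation (charTwistCoeff f χ) (LChar f χ) := by
  exact isEntireContinuation_continuedLSeries ⟨_, (IsEntireContinuation.sum Finset.univ fun j _ =>
    (isEntireContinuation_LAdd hf _).mul_left _).congr fun n _ => charTwistCoeff_eq_sum χ n⟩

lemma LAdd_add_intCast (f : CuspForm 𝒮ℒ (k : ℤ)) (α : ℚ) (m : ℤ) (s : ℂ) :
    LAdd f (α + m) s = LAdd f α s := by
  have h : addTwistCoeff f (α + m) = addTwistCoeff f α := by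
    funext n
    have h1 := exp_int_mul_two_pi_mul_I (n * m)
    rw [addTwistCoeff, addTwistCoeff,
      show (2 * Real.pi * I * n * ((α + m : ℚ) : ℂ) : ℂ) =
        2 * Real.pi * I * n * α + ((n * m : ℤ) : ℂ) * (2 * Real.pi * I) by push_cast; ring,
      Complex.exp_add, h1, mul_one]
  rw [LAdd, LAdd, h]

lemma LAdd_congr (f : CuspForm 𝒮ℒ (k : ℤ)) {u v : ℤ} {N : ℕ} (hN : N ≠ 0) (h : u ≡ v [ZMOD N])
    (s : ℂ) : LAdd f (u / N) s = LAdd f (v / N) s := by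
  obtain ⟨m, hm⟩ := h.dvd
  have hN' : (N : ℚ) ≠ 0 := by exact_mod_cast hN
  have e : (v / N : ℚ) = u / N + m := by
    have : (v : ℚ) - u = N * m := by exact_mod_cast hm
    field_simp
    linarith
  rw [e, LAdd_add_intCast]

end LFunctions

end HeckeReciprocity

/-! ### The twisted moment as a central value of an additive twist. -/

namespace HeckeReciprocity

open Complex Filter Topology

section Moment

variable {k : ℕ} {f : CuspForm 𝒮ℒ (k : ℤ)}

lemma isPrimitive_iff_ne_one {q : ℕ} [Fact q.Prime] (χ : DirichletCharacter ℂ q) :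
    χ.IsPrimitive ↔ χ ≠ 1 := by
  have hq : q.Prime := Fact.out
  rw [DirichletCharacter.isPrimitive_def]
  have h := χ.conductor_dvd_level
  have h1 : χ = 1 ↔ χ.conductor = 1 := DirichletCharacter.eq_one_iff_conductor_eq_one
  rw [ne_eq, h1]
  rcases (Nat.dvd_prime hq).mp h with h2 | h2
  · simp [h2, hq.ne_one.symm]
  · simp [h2, hq.ne_one]

/-- Once the Gauss sum is expanded, orthogonality over χ leaves only the term y = x. -/
lemma sum_gaussSum_mul {q : ℕ} [Fact q.Prime] (x : (ZMod q)ˣ) :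
    ∑ χ : DirichletCharacter ℂ q, gaussSum χ ZMod.stdAddChar * χ (x⁻¹ : (ZMod q)ˣ) =
      q.totient * ZMod.stdAddChar (x : ZMod q) := by
  have h (χ : DirichletCharacter ℂ q) :
      gaussSum χ ZMod.stdAddChar * χ (x⁻¹ : (ZMod q)ˣ) =
        ∑ y : ZMod q, (χ (x : ZMod q)⁻¹ * χ y) * ZMod.stdAddChar y := by
    rw [gaussSum, Finset.sum_mul, ← ZMod.inv_coe_unit x]
    exact Finset.sum_congr rfl fun y _ => by ring
  simp only [h]
  rw [Finset.sum_comm]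
  simp only [← Finset.sum_mul]
  simp only [DirichletCharacter.sum_char_inv_mul_char_eq ℂ x.isUnit]
  simp

/-- Orthogonality turns the sum over primitive characters into an additive character. -/
lemma sum_primitive_gaussSum {q : ℕ} [Fact q.Prime] {a b u : ℤ} (ha : (a : ZMod q) ≠ 0)
    (hb : (b : ZMod q) ≠ 0) (hu : (a : ZMod q) * u = b) (n : ℕ) :
    ∑ χ ∈ (Finset.univ : Finset (DirichletCharacter ℂ q)).erase 1,
      gaussSum χ ZMod.stdAddChar * χ (a : ZMod q) * χ⁻¹ (b : ZMod q) * χ⁻¹ (n : ZMod q) =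
      q.totient * ZMod.stdAddChar ((u : ZMod q) * (n : ZMod q)) + 1 -
        (q.totient + 1) * if q ∣ n then 1 else 0 := by
  have hq : q.Prime := Fact.out
  -- If q ∣ n all characters vanish at n, and the correction φ(q) + 1 is what makes the right side
  -- zero. If q ∤ n, the missing trivial character, whose Gauss sum is -1, accounts for the + 1.
  by_cases hn : (n : ZMod q) = 0
  · have h1 : q ∣ n := (ZMod.natCast_eq_zero_iff n q).mp hn
    have h2 (χ : DirichletCharacter ℂ q) : χ⁻¹ (0 : ZMod q) = 0 :=
      MulChar.map_nonunit _ not_isUnit_zero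
    simp [hn, h1, h2]
  · have h1 : ¬ q ∣ n := fun h => hn ((ZMod.natCast_eq_zero_iff n q).mpr h)
    rw [if_neg h1, mul_zero, sub_zero]
    have hu0 : (u : ZMod q) ≠ 0 := fun h => hb (by rw [← hu, h, mul_zero])
    let x : (ZMod q)ˣ := Units.mk0 ((u : ZMod q) * n) (mul_ne_zero hu0 hn)
    have hx : ((x⁻¹ : (ZMod q)ˣ) : ZMod q) = a * ((b : ZMod q)⁻¹ * (n : ZMod q)⁻¹) := by
      simp only [x, Units.val_inv_eq_inv_val, Units.val_mk0]
      rw [← hu]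
      field_simp
    have e (χ : DirichletCharacter ℂ q) :
        gaussSum χ ZMod.stdAddChar * χ (a : ZMod q) * χ⁻¹ (b : ZMod q) * χ⁻¹ (n : ZMod q) =
          gaussSum χ ZMod.stdAddChar * χ (x⁻¹ : (ZMod q)ˣ) := by
      rw [hx, map_mul, map_mul, MulChar.inv_apply', MulChar.inv_apply']
      ring
    have hone : gaussSum (1 : DirichletCharacter ℂ q) ZMod.stdAddChar *
        (1 : DirichletCharacter ℂ q) (x⁻¹ : (ZMod q)ˣ) = -1 := by
      rw [MulChar.one_apply_coe, mul_one]
      refine gaussSum_one_left ?_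
      have := ZMod.isPrimitive_stdAddChar q
      intro h
      exact this (a := 1) one_ne_zero (by simp [AddChar.mulShift_one, h])
    simp only [e]
    have h3 := Finset.add_sum_erase Finset.univ
      (fun χ : DirichletCharacter ℂ q => gaussSum χ ZMod.stdAddChar * χ (x⁻¹ : (ZMod q)ˣ))
      (Finset.mem_univ 1)
    rw [sum_gaussSum_mul x, hone] at h3
    have hxv : (x : ZMod q) = (u : ZMod q) * n := rfl
    rw [hxv] at h3
    linear_combination h3

/-- The part of `L(s, f)` supported on multiples of a prime. -/
lemma isEntireContinuation_lam_multiples (hf : IsHeckeCuspForm f) {q : ℕ} (hq : q.Prime) :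
    IsEntireContinuation (fun n => lam f n * if q ∣ n then 1 else 0)
      fun s => (q : ℂ) ^ (-s) * (lam f q * LFun f s - (q : ℂ) ^ (-s) * LFun f s) := by
  have h := isEntireContinuation_LFun hf
  refine (((h.mul_left (lam f q)).sub (h.dilate hq.ne_zero)).dilate hq.ne_zero).congr
    fun n _ => ?_
  by_cases hn : q ∣ n
  · rw [if_pos hn, if_pos hn]
    obtain ⟨l, rfl⟩ := hn
    rw [Nat.mul_div_cancel_left _ hq.pos, lam_mul_prime hf hq, mul_one, add_sub_cancel_right]
  · rw [if_neg hn, if_neg hn, mul_zero]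

/-- The twisted moment is the central value of an additive twist. -/
theorem twistedMoment_eq_LAdd (hf : IsHeckeCuspForm f) {q : ℕ} [Fact q.Prime] {a b u : ℤ}
    (ha : (a : ZMod q) ≠ 0) (hb : (b : ZMod q) ≠ 0) (hu : (a : ZMod q) * u = b) :
    twistedMoment f a b q = LAdd f (u / q) (1 / 2) := by
  have hq : q.Prime := Fact.out
  classical
  have hset : ((Finset.univ : Finset (DirichletCharacter ℂ q)).filter fun χ => χ.IsPrimitive) =
      Finset.univ.erase 1 := by
    ext χ
    simp [isPrimitive_iff_ne_one]
  have h1 := IsEntireContinuation.sum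
    ((Finset.univ : Finset (DirichletCharacter ℂ q)).erase 1) fun χ _ =>
    (isEntireContinuation_LChar hf χ⁻¹).mul_left
      (gaussSum χ ZMod.stdAddChar * χ (a : ZMod q) * χ⁻¹ (b : ZMod q))
  have h2 := (((isEntireContinuation_LAdd hf (u / q)).mul_left (q.totient : ℂ)).add
    (isEntireContinuation_LFun hf)).sub
    ((isEntireContinuation_lam_multiples hf hq).mul_left ((q.totient : ℂ) + 1))
  -- Both sides continue the same Dirichlet series, so the identity of coefficients passes to s =
  -- 1/2.
  have h3 := (h1.congr (b := _) fun n _ => ?_).unique h2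
  · have h4 := congrFun h3 (1 / 2)
    have hφ : (q.totient : ℂ) = q - 1 := by
      rw [Nat.totient_prime hq, Nat.cast_sub hq.one_le, Nat.cast_one]
    have hφ0 : (q.totient : ℂ) ≠ 0 := by
      exact_mod_cast (Nat.totient_pos.mpr hq.pos).ne'
    have hq0 : (q : ℂ) ≠ 0 := by exact_mod_cast hq.ne_zero
    set Q := (q : ℂ) ^ (1 / 2 : ℂ) with hQ
    have hQ0 : Q ≠ 0 := by simp [hQ, cpow_eq_zero_iff, hq0]
    have hQQ : (q : ℂ) = Q * Q := by
      rw [hQ, ← cpow_add _ _ hq0]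
      norm_num
    have hQi : (q : ℂ) ^ (-(1 / 2) : ℂ) = Q⁻¹ := cpow_neg _ _
    simp only [twistedMoment]
    rw [show (∑ χ : DirichletCharacter ℂ q with χ.IsPrimitive,
        gaussSum χ ZMod.stdAddChar * LChar f χ⁻¹ (1 / 2) * χ (a : ZMod q) * χ⁻¹ (b : ZMod q)) = _
      from Finset.sum_congr (by convert hset) fun _ _ => rfl]
    have e : ∑ χ ∈ (Finset.univ : Finset (DirichletCharacter ℂ q)).erase 1,
        gaussSum χ ZMod.stdAddChar * LChar f χ⁻¹ (1 / 2) * χ (a : ZMod q) * χ⁻¹ (b : ZMod q) =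
        ∑ χ ∈ (Finset.univ : Finset (DirichletCharacter ℂ q)).erase 1,
        gaussSum χ ZMod.stdAddChar * χ (a : ZMod q) * χ⁻¹ (b : ZMod q) *
          LChar f χ⁻¹ (1 / 2) := Finset.sum_congr rfl fun χ _ => by ring
    -- With Q = √q and φ(q) + 1 = q, the part on multiples of q contributes -(λ_f(q)Q - 1)L(1/2, f).
    -- Together with the + L(1/2, f) this cancels the last term of the moment.
    rw [e, h4, ← hQ, hQi, inv_mul_eq_div, div_eq_iff hφ0]
    generalize LAdd f (u / q) (1 / 2) = L
    rw [hφ, hQQ]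
    field_simp
    ring
  · simp only [charTwistCoeff, addTwistCoeff_intCast_div]
    have := sum_primitive_gaussSum ha hb hu n
    have e : ∑ χ ∈ (Finset.univ : Finset (DirichletCharacter ℂ q)).erase 1,
        gaussSum χ ZMod.stdAddChar * χ (a : ZMod q) * χ⁻¹ (b : ZMod q) *
          (lam f n * χ⁻¹ (n : ZMod q)) = lam f n *
        ∑ χ ∈ (Finset.univ : Finset (DirichletCharacter ℂ q)).erase 1,
        gaussSum χ ZMod.stdAddChar * χ (a : ZMod q) * χ⁻¹ (b : ZMod q) * χ⁻¹ (n : ZMod q) := by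
      rw [Finset.mul_sum]
      exact Finset.sum_congr rfl fun χ _ => by ring
    rw [e, this]
    ring

end Moment

end HeckeReciprocity

/-! ### Primitives on the upper half plane and their limits at cusps. -/

namespace HeckeReciprocity

open Complex Filter Topology MeasureTheory

section Primitive

/-- A holomorphic function on the upper half plane has a primitive. -/
lemma exists_primitive_upperHalfPlane {h : ℂ → ℂ} (hh : ∀ z : ℂ, 0 < z.im → DifferentiableAt ℂ h z) :
    ∃ G : ℂ → ℂ, ∀ z : ℂ, 0 < z.im → HasDerivAt G (h z) z := by
  -- The Cayley transform carries the problem to the unit disc, where holomorphic functions have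
  -- primitives.
  have him (w : ℂ) (hw : ‖w‖ < 1) : 0 < (I * (1 + w) / (1 - w)).im := by
    have hw' : normSq w < 1 := by
      rw [normSq_eq_norm_sq]
      nlinarith [norm_nonneg w]
    have h1 : (1 - w) ≠ 0 := by
      intro h
      rw [← sub_eq_zero.mp h] at hw
      simp at hw
    have h2 : (I * (1 + w) / (1 - w)).im = (1 - normSq w) / normSq (1 - w) := by
      rw [div_im, normSq_apply w]
      simp only [mul_im, I_re, I_im, add_re, one_re, add_im, one_im, mul_re, sub_re, sub_im]
      ring
    rw [h2]
    exact div_pos (by linarith) (normSq_pos.mpr h1)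
  have hball : DifferentiableOn ℂ (fun w => h (I * (1 + w) / (1 - w)) * (2 * I / (1 - w) ^ 2))
      (Metric.ball 0 1) := by
    intro w hw
    rw [mem_ball_zero_iff] at hw
    have h1 : (1 - w) ≠ 0 := by
      intro h
      rw [← sub_eq_zero.mp h] at hw
      simp at hw
    have h2 : DifferentiableAt ℂ (fun w => I * (1 + w) / (1 - w)) w :=
      DifferentiableAt.div (by fun_prop) (by fun_prop) h1
    have h3 : DifferentiableAt ℂ (fun w => 2 * I / (1 - w) ^ 2) w :=
      DifferentiableAt.div (by fun_prop) (by fun_prop) (pow_ne_zero 2 h1)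
    exact (((hh _ (him w hw)).comp w h2).mul h3).differentiableWithinAt
  obtain ⟨g, hg⟩ := hball.isExactOn_ball
  refine ⟨fun z => g ((z - I) / (z + I)), fun z hz => ?_⟩
  have hz1 : z + I ≠ 0 := by
    intro h
    have := congrArg Complex.im h
    simp at this
    linarith
  have hball : ‖(z - I) / (z + I)‖ < 1 := by
    rw [norm_div, div_lt_one (norm_pos_iff.mpr hz1)]
    refine lt_of_pow_lt_pow_left₀ 2 (norm_nonneg _) ?_
    rw [← normSq_eq_norm_sq, ← normSq_eq_norm_sq, normSq_apply, normSq_apply]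
    simp only [sub_re, sub_im, add_re, add_im, I_re, I_im]
    nlinarith
  have h1 := hg ((z - I) / (z + I)) (by rwa [mem_ball_zero_iff])
  have h2 : HasDerivAt (fun z : ℂ => (z - I) / (z + I)) (2 * I / (z + I) ^ 2) z := by
    have := ((hasDerivAt_id z).sub_const I).div ((hasDerivAt_id z).add_const I) hz1
    refine HasDerivAt.congr_deriv this ?_
    simp only [id]
    ring
  have h3 := h1.comp z h2
  have e1 : 1 - (z - I) / (z + I) = 2 * I / (z + I) := by
    field_simp
    ring
  have e2 : I * (1 + (z - I) / (z + I)) / (2 * I / (z + I)) = z := by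
    have := I_ne_zero
    field_simp
    ring
  simp only [e1, e2] at h3
  refine HasDerivAt.congr_deriv h3 ?_
  have := I_ne_zero
  field_simp

/-- A primitive of a function decaying in vertical strips has a limit at infinity. -/
lemma exists_tendsto_of_hasDerivAt {h H : ℂ → ℂ}
    (hH : ∀ z : ℂ, 0 < z.im → HasDerivAt H (h z) z)
    (hb : ∀ R : ℝ, ∃ C, ∀ z : ℂ, |z.re| ≤ R → 1 ≤ z.im → ‖h z‖ ≤ C / z.im ^ 2)
    (hc : ContinuousOn h {z : ℂ | 0 < z.im}) :
    ∃ V, ∀ x : ℝ, Tendsto (fun t : ℝ => H (x + t * I)) atTop (𝓝 V) := by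
  have hline (x t : ℝ) (ht : 0 < t) :
      HasDerivAt (fun t : ℝ => H (x + t * I)) (h (x + t * I) * I) t := by
    have h1 : HasDerivAt (fun t : ℝ => (x + t * I : ℂ)) I t := by
      simpa using ((hasDerivAt_id t).ofReal_comp.mul_const I).const_add (x : ℂ)
    exact (hH (x + t * I) (by simpa using ht)).comp t h1
  have h0 : ∃ V, Tendsto (fun t : ℝ => H ((0 : ℝ) + t * I)) atTop (𝓝 V) := by
    obtain ⟨C, hC⟩ := hb 0
    refine ⟨_, tendsto_limUnder_of_hasDerivAt_of_integrableOn_Ioi (a := 1)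
      (fun t ht => hline 0 t (one_pos.trans ht)) ?_⟩
    have hint : IntegrableOn (fun t : ℝ => C * t ^ (-2 : ℝ)) (Set.Ioi 1) :=
      (integrableOn_Ioi_rpow_of_lt (by norm_num) one_pos).const_mul C
    refine Integrable.mono' hint ?_ ?_
    · refine ContinuousOn.aestronglyMeasurable ?_ measurableSet_Ioi
      refine ContinuousOn.mul (hc.comp (by fun_prop) fun t ht => ?_) continuousOn_const
      simpa using one_pos.trans ht
    · refine (ae_restrict_iff' measurableSet_Ioi).mpr (ae_of_all _ fun t ht => ?_)
      have ht' : (1 : ℝ) < t := ht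
      have h2 := hC ((0 : ℝ) + t * I) (by simp) (by simpa using ht'.le)
      rw [norm_mul, norm_I, mul_one]
      refine h2.trans (le_of_eq ?_)
      rw [show (-2 : ℝ) = ((-2 : ℤ) : ℝ) by norm_num, Real.rpow_intCast, div_eq_mul_inv]
      simp
  obtain ⟨V, hV⟩ := h0
  refine ⟨V, fun x => ?_⟩
  obtain ⟨C, hC⟩ := hb |x|
  -- Two vertical lines are joined by a horizontal segment of fixed length at height t, where the
  -- derivative is O(1/t²).
  have hdiff : Tendsto (fun t : ℝ => H (x + t * I) - H ((0 : ℝ) + t * I)) atTop (𝓝 0) := by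
    refine squeeze_zero_norm' (a := fun t : ℝ => (|C| / t ^ 2) * |x|) ?_ ?_
    · filter_upwards [eventually_ge_atTop 1] with t ht
      have ht0 : 0 < t := one_pos.trans_le ht
      have h1 := Convex.norm_image_sub_le_of_norm_hasDerivWithin_le (𝕜 := ℝ)
        (f := fun u : ℝ => H (u + t * I)) (f' := fun u : ℝ => h (u + t * I))
        (s := Set.Icc (-|x|) |x|) (C := |C| / t ^ 2) (x := 0) (y := x) ?_ ?_ (convex_Icc _ _)
        (by simp) (by simp [neg_abs_le, le_abs_self])
      · simpa using h1
      · intro u _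
        have h2 : HasDerivAt (fun u : ℝ => (u + t * I : ℂ)) 1 u := by
          simpa using (hasDerivAt_id u).ofReal_comp.add_const (t * I)
        have h3 := (hH (u + t * I) (by simpa using ht0)).comp u h2
        rw [mul_one] at h3
        exact h3.hasDerivWithinAt
      · intro u hu
        have h2 := hC (u + t * I) (by simpa using abs_le.mpr hu) (by simpa using ht)
        refine h2.trans ?_
        simp only [add_im, ofReal_im, mul_im, ofReal_re, I_im, mul_one, I_re, mul_zero, add_zero,
          zero_add]
        gcongr
        exact le_abs_self C
    · have h1 : Tendsto (fun t : ℝ => |C| / t ^ 2) atTop (𝓝 0) :=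
        tendsto_const_nhds.div_atTop (tendsto_pow_atTop two_ne_zero)
      simpa using h1.mul_const |x|
  simpa using hdiff.add hV

/-- The endpoint 0 lies outside the half plane, so the value of φ there is meaningless and is
replaced by the limit u. -/
lemma integral_Ioi_eq_of_tendsto {φ φ' : ℝ → ℂ} {u v : ℂ}
    (hd : ∀ t : ℝ, 0 < t → HasDerivAt φ (φ' t) t) (hi : IntegrableOn φ' (Set.Ioi 0))
    (h0 : Tendsto φ (𝓝[>] 0) (𝓝 u)) (h1 : Tendsto φ atTop (𝓝 v)) :
    ∫ t in Set.Ioi (0 : ℝ), φ' t = v - u := by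
  have h := integral_Ioi_of_hasDerivAt_of_tendsto (f := Function.update φ 0 u) (f' := φ') (a := 0)
    (m := v) ?_ ?_ hi ?_
  · rwa [Function.update_self] at h
  · rw [continuousWithinAt_update_same]
    convert h0 using 2
    ext t
    simp [lt_iff_le_and_ne, eq_comm]
  · intro t ht
    refine (hd t ht).congr_of_eventuallyEq ?_
    filter_upwards [eventually_ne_nhds (ne_of_gt ht)] with s hs
    exact Function.update_of_ne hs _ _
  · refine h1.congr' ?_
    filter_upwards [eventually_ne_atTop 0] with s hs
    exact (Function.update_of_ne hs _ _).symm

/-- Turns the approach to a cusp along a vertical line into an approach to infinity after a Möbius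
transformation, which sends height t to 1/(Ct). -/
lemma tendsto_zero_of_tendsto_inv {φ ψ : ℝ → ℂ} {V : ℂ} {C : ℝ} (hC : 0 < C)
    (hψ : ∀ t : ℝ, 0 < t → ψ t = φ (C * t)⁻¹) (h : Tendsto φ atTop (𝓝 V)) :
    Tendsto ψ (𝓝[>] 0) (𝓝 V) := by
  have h1 : Tendsto (fun t : ℝ => (C * t)⁻¹) (𝓝[>] 0) atTop := by
    have := tendsto_inv_nhdsGT_zero (𝕜 := ℝ)
    refine (this.const_mul_atTop (inv_pos.mpr hC)).congr fun t => ?_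
    rw [mul_inv]
  refine (h.comp h1).congr' ?_
  filter_upwards [self_mem_nhdsWithin] with t ht
  exact (hψ t ht).symm

end Primitive

section CuspLimit

variable {k : ℕ} (f : CuspForm 𝒮ℒ (k : ℤ))

/-- The pullback of `f(z) ((z - A) (z - B))^m dz` under a matrix. -/
noncomputable def kernel (m : ℕ) (A B a b c d : ℝ) (w : ℂ) : ℂ :=
  onPlane f w * (((a - A * c : ℝ) * w + (b - A * d : ℝ)) *
    ((a - B * c : ℝ) * w + (b - B * d : ℝ))) ^ m

lemma differentiableAt_kernel (m : ℕ) (A B a b c d : ℝ) {w : ℂ} (hw : 0 < w.im) :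
    DifferentiableAt ℂ (kernel f m A B a b c d) w :=
  (differentiableAt_onPlane f hw).mul (by fun_prop)

lemma hasDerivAt_moebius {a b c d : ℝ} (hdet : a * d - b * c = 1) {w : ℂ} (hw : 0 < w.im) :
    HasDerivAt (fun w : ℂ => (a * w + b) / (c * w + d)) (1 / (c * w + d) ^ 2) w := by
  have h0 := denom_ne_zero hdet hw
  have h1 := (((hasDerivAt_id w).const_mul (a : ℂ)).add_const (b : ℂ)).div
    (((hasDerivAt_id w).const_mul (c : ℂ)).add_const (d : ℂ)) h0
  refine HasDerivAt.congr_deriv h1 ?_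
  have hdet' : (a * d - b * c : ℂ) = 1 := by exact_mod_cast hdet
  simp only [id, mul_one]
  congr 1
  linear_combination hdet'

/-- The automorphy factors cancel: f contributes (cw + d)^k, the 2m linear factors (cw + d)^(-2m),
and dz contributes (cw + d)^(-2), with k = 2m + 2. -/
lemma hasDerivAt_primitive_comp_moebius {m : ℕ} (hk : k = 2 * m + 2) {A B : ℝ} {G : ℂ → ℂ}
    (hG : ∀ z : ℂ, 0 < z.im → HasDerivAt G (kernel f m A B 1 0 0 1 z) z) {a b c d : ℤ}
    (hdet : a * d - b * c = 1) {w : ℂ} (hw : 0 < w.im) :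
    HasDerivAt (fun w : ℂ => G ((a * w + b) / (c * w + d))) (kernel f m A B a b c d w) w := by
  have hdet' : (a * d - b * c : ℝ) = 1 := by exact_mod_cast hdet
  have h0 := denom_ne_zero hdet' hw
  have him := im_moebius_pos hdet' hw
  have h1 := hasDerivAt_moebius hdet' hw
  simp only [ofReal_intCast] at h0 him h1
  have h2 := (hG _ him).comp w h1
  refine HasDerivAt.congr_deriv h2 (Eq.symm ?_)
  rw [kernel, kernel, onPlane_moebius f hdet hw,
    show (c * w + d : ℂ) ^ k = (c * w + d) ^ (2 * m + 2) by rw [hk]]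
  push_cast
  have e (X : ℂ) : (1 - X * 0) * ((a * w + b) / (c * w + d)) + (0 - X * 1) =
      ((a - X * c) * w + (b - X * d)) / (c * w + d) := by
    rw [eq_div_iff h0]
    linear_combination div_mul_cancel₀ (a * w + b : ℂ) h0
  rw [e, e, div_mul_div_comm, div_pow, pow_add, pow_mul, ← pow_two]
  field_simp

/-- In a strip the polynomial factor is O(y^(2m)), while f is O(y^(-(2m+2))). -/
lemma exists_norm_kernel_le {m : ℕ} (hk : k = 2 * m + 2) (A B a b c d R : ℝ) :
    ∃ C, ∀ w : ℂ, |w.re| ≤ R → 1 ≤ w.im → ‖kernel f m A B a b c d w‖ ≤ C / w.im ^ 2 := by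
  obtain ⟨K, hK0, hK⟩ := exists_pow_im_mul_norm_le f (n := 2 * m + 2) (by omega)
  have hlin (u v : ℝ) (w : ℂ) (h1 : |w.re| ≤ R) (h2 : 1 ≤ w.im) :
      ‖(u : ℂ) * w + v‖ ≤ (|u| * (R + 1) + |v|) * w.im := by
    have hR : 0 ≤ R := (abs_nonneg _).trans h1
    have h3 : ‖w‖ ≤ (R + 1) * w.im := by
      have := norm_le_abs_re_add_abs_im w
      rw [abs_of_nonneg (zero_le_one.trans h2)] at this
      nlinarith
    calc ‖(u : ℂ) * w + v‖ ≤ |u| * ‖w‖ + |v| := by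
          refine (norm_add_le _ _).trans (le_of_eq ?_)
          rw [norm_mul, norm_real, norm_real, Real.norm_eq_abs, Real.norm_eq_abs]
      _ ≤ |u| * ((R + 1) * w.im) + |v| * w.im := by
          gcongr
          exact le_mul_of_one_le_right (abs_nonneg _) h2
      _ = _ := by ring
  refine ⟨K * ((|a - A * c| * (R + 1) + |b - A * d|) * (|a - B * c| * (R + 1) + |b - B * d|)) ^ m,
    fun w h1 h2 => ?_⟩
  have hw : 0 < w.im := one_pos.trans_le h2
  have hR : 0 ≤ R := (abs_nonneg _).trans h1
  rw [kernel, norm_mul, norm_pow, norm_mul, le_div_iff₀ (by positivity)]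
  calc ‖onPlane f w‖ * (‖((a - A * c : ℝ) : ℂ) * w + (b - A * d : ℝ)‖ *
        ‖((a - B * c : ℝ) : ℂ) * w + (b - B * d : ℝ)‖) ^ m * w.im ^ 2
      ≤ ‖onPlane f w‖ * (((|a - A * c| * (R + 1) + |b - A * d|) * w.im) *
        ((|a - B * c| * (R + 1) + |b - B * d|) * w.im)) ^ m * w.im ^ 2 := by
        gcongr
        · exact hlin _ _ w h1 h2
        · exact hlin _ _ w h1 h2
    _ = (w.im ^ (2 * m + 2) * ‖onPlane f w‖) * ((|a - A * c| * (R + 1) + |b - A * d|) *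
        (|a - B * c| * (R + 1) + |b - B * d|)) ^ m := by
        generalize |a - A * c| * (R + 1) + |b - A * d| = X
        generalize |a - B * c| * (R + 1) + |b - B * d| = Y
        ring
    _ ≤ _ := by
        gcongr
        exact hK w hw

/-- The primitive has a limit at every cusp. -/
lemma exists_cusp_limit {m : ℕ} (hk : k = 2 * m + 2) {A B : ℝ} {G : ℂ → ℂ}
    (hG : ∀ z : ℂ, 0 < z.im → HasDerivAt G (kernel f m A B 1 0 0 1 z) z) {a b c d : ℤ}
    (hdet : a * d - b * c = 1) :
    ∃ V, ∀ x : ℝ, Tendsto (fun t : ℝ => G ((a * (x + t * I) + b) / (c * (x + t * I) + d))) atTop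
      (𝓝 V) :=
  exists_tendsto_of_hasDerivAt
    (fun _ hw => hasDerivAt_primitive_comp_moebius f hk hG hdet hw)
    (fun R => exists_norm_kernel_le f hk A B a b c d R)
    (fun _ hw => (differentiableAt_kernel f m A B a b c d hw).continuousAt.continuousWithinAt)

end CuspLimit

end HeckeReciprocity

/-! ### Period integrals, the functional equation and the geodesic triangle. -/

namespace HeckeReciprocity

open Complex Filter Topology MeasureTheory

section VerticalIntegral

variable {k : ℕ} (f : CuspForm 𝒮ℒ (k : ℤ))

/-- The period integral along the vertical line above `α`. -/
noncomputable def vint (α : ℚ) (n : ℕ) : ℂ :=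
  ∫ t in Set.Ioi (0 : ℝ), onPlane f (α + t * I) * (t : ℂ) ^ n

lemma mellin_eq_vint (α : ℚ) (n : ℕ) :
    mellin (fun t : ℝ => onPlane f (α + t * I)) ((n : ℂ) + 1) = vint f α n := by
  rw [mellin, vint]
  refine setIntegral_congr_fun measurableSet_Ioi fun t _ => ?_
  simp only [add_sub_cancel_right, cpow_natCast, smul_eq_mul, mul_comm]

lemma integrableOn_vint (hk : Even k) (α : ℚ) (n : ℕ) :
    IntegrableOn (fun t : ℝ => onPlane f (α + t * I) * (t : ℂ) ^ n) (Set.Ioi 0) := by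
  have h := mellinConvergent_vertical f α hk ((n : ℂ) + 1)
  rw [MellinConvergent] at h
  refine h.congr_fun (fun t _ => ?_) measurableSet_Ioi
  simp only [add_sub_cancel_right, cpow_natCast, smul_eq_mul, mul_comm]

/-- The normalizing shift sends 1/2 + j to the integer m + j + 1, so the Gamma factor is a factorial
and the Mellin transform is a moment of f. -/
lemma LAdd_half_add {f : CuspForm 𝒮ℒ (k : ℤ)} (hf : IsHeckeCuspForm f) {m : ℕ}
    (hk : k = 2 * m + 2) (α : ℚ) (j : ℕ) :
    LAdd f α (1 / 2 + j) =
      (2 * Real.pi : ℂ) ^ (m + j + 1) * ((m + j).factorial : ℂ)⁻¹ * vint f α (m + j) /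
        coeff f 1 := by
  have e : (1 / 2 + j + ((k : ℂ) - 1) / 2) = ((m + j : ℕ) : ℂ) + 1 := by
    rw [show (k : ℂ) = 2 * m + 2 by rw [hk]; push_cast; ring]
    push_cast
    ring
  rw [LAdd_eq hf, addIntegral, e, mellin_eq_vint, Gamma_nat_eq_factorial]
  congr 3
  exact_mod_cast cpow_natCast (2 * Real.pi : ℂ) (m + j + 1)

/-- The functional equation of the central value. -/
lemma vint_functional_equation {m : ℕ} (hk : k = 2 * m + 2) {a b c d : ℤ}
    (hdet : a * d - b * c = 1) (hc : 0 < c) :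
    vint f (a / c) m = I ^ k * vint f (-d / c) m := by
  have hc' : (0 : ℝ) < (c : ℝ) ^ 2 := by
    have : (0 : ℝ) < c := by exact_mod_cast hc
    positivity
  have hc0 : (c : ℂ) ≠ 0 := by exact_mod_cast hc.ne'
  set g : ℝ → ℂ := fun t => onPlane f (((a / c : ℚ) : ℂ) + t * I) with hg
  have h1 := mellin_comp_inv g (-((m : ℂ) + 1))
  have h2 := mellin_comp_mul_left (fun t : ℝ => g t⁻¹) (-((m : ℂ) + 1)) hc'
  rw [h1, neg_neg, mellin_eq_vint] at h2
  have h3 : mellin (fun t : ℝ => g ((c : ℝ) ^ 2 * t)⁻¹) (-((m : ℂ) + 1)) =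
      ((c : ℂ) * I) ^ k * vint f (-d / c) m := by
    have e4 : vint f (-d / c) m = mellin (fun t : ℝ => onPlane f (((-d / c : ℚ) : ℂ) + t * I))
        (-((m : ℂ) + 1) + k) := by
      rw [← mellin_eq_vint]
      congr 1
      rw [show (k : ℂ) = 2 * m + 2 by rw [hk]; push_cast; ring]
      ring
    rw [e4, ← mellin_cpow_smul, ← smul_eq_mul, ← mellin_const_smul]
    rw [mellin, mellin]
    refine setIntegral_congr_fun measurableSet_Ioi fun t ht => ?_
    have h4 := onPlane_above_pole f hdet hc.ne' (s := t) ht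
    have e1 : ((a / c : ℝ) : ℂ) = ((a / c : ℚ) : ℂ) := by push_cast; rfl
    have e2 : ((-d / c : ℝ) : ℂ) = ((-d / c : ℚ) : ℂ) := by push_cast; rfl
    rw [e1, e2] at h4
    simp only [hg, smul_eq_mul, cpow_natCast]
    rw [h4]
    ring
  rw [h3, smul_eq_mul, ofReal_pow, ofReal_intCast] at h2
  -- At the central point m + 1 = k/2 the factor from rescaling by c² equals the one from
  -- modularity, so both cancel.
  have e3 : ((c : ℂ) ^ 2) ^ ((m : ℂ) + 1) = (c : ℂ) ^ k := by
    rw [show (m : ℂ) + 1 = ((m + 1 : ℕ) : ℂ) by push_cast; rfl, cpow_natCast, ← pow_mul, hk]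
    ring_nf
  rw [e3, mul_pow, mul_assoc] at h2
  exact (mul_left_cancel₀ (pow_ne_zero k hc0) h2).symm

lemma kernel_one_symm (m : ℕ) (A B : ℝ) : kernel f m A B 1 0 0 1 = kernel f m B A 1 0 0 1 := by
  funext w
  simp only [kernel]
  congr 2
  ring

lemma kernel_vertical (m : ℕ) (A : ℚ) (B : ℝ) (t : ℝ) :
    kernel f m A B 1 0 0 1 (A + t * I) =
      onPlane f (A + t * I) * (t * I * (t * I + (A - B))) ^ m := by
  rw [kernel]
  congr 2
  push_cast
  ring

/-- On the line above A the factor z - A is it, so the j-th binomial term carries t^(m+j), the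
moment that computes L(1/2 + j). -/
lemma kernel_vertical_expand (m : ℕ) (A : ℚ) (B : ℝ) (t : ℝ) :
    kernel f m A B 1 0 0 1 (A + t * I) * I =
      ∑ j ∈ Finset.range (m + 1), (m.choose j * I ^ (m + 1 + j) * ((A : ℂ) - B) ^ (m - j)) *
        (onPlane f (A + t * I) * (t : ℂ) ^ (m + j)) := by
  rw [kernel_vertical, mul_pow, add_pow, Finset.mul_sum, Finset.mul_sum, Finset.sum_mul]
  refine Finset.sum_congr rfl fun j _ => ?_
  ring

lemma integrableOn_kernel_vertical (hk : Even k) (m : ℕ) (A : ℚ) (B : ℝ) :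
    IntegrableOn (fun t : ℝ => kernel f m A B 1 0 0 1 (A + t * I) * I) (Set.Ioi 0) := by
  simp only [kernel_vertical_expand]
  exact integrable_finsetSum _ fun j _ => (integrableOn_vint f hk A (m + j)).const_mul _

lemma integral_kernel_vertical (hk : Even k) (m : ℕ) (A : ℚ) (B : ℝ) :
    ∫ t in Set.Ioi (0 : ℝ), kernel f m A B 1 0 0 1 (A + t * I) * I =
      ∑ j ∈ Finset.range (m + 1), (m.choose j * I ^ (m + 1 + j) * ((A : ℂ) - B) ^ (m - j)) *
        vint f A (m + j) := by
  simp only [kernel_vertical_expand]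
  rw [integral_finsetSum _ fun j _ => (integrableOn_vint f hk A (m + j)).const_mul _]
  simp only [integral_const_mul, vint]

lemma hasDerivAt_comp_vertical {H : ℂ → ℂ} {h : ℂ} {x t : ℝ} (hH : HasDerivAt H h (x + t * I)) :
    HasDerivAt (fun t : ℝ => H (x + t * I)) (h * I) t := by
  have h1 : HasDerivAt (fun t : ℝ => (x + t * I : ℂ)) I t := by
    simpa using ((hasDerivAt_id t).ofReal_comp.mul_const I).const_add (x : ℂ)
  exact hH.comp t h1

/-- The geodesic triangle with vertices `A = a' / c'`, `B = a / c` and infinity. -/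
theorem integral_triangle {m : ℕ} (hk : k = 2 * m + 2) {a b c d a' b' c' d' : ℤ}
    (hdet : a * d - b * c = 1) (hdet' : a' * d' - b' * c' = 1) (hc : 0 < c) (hc' : 0 < c')
    (hD : 0 < a * c' - c * a') {A B x : ℚ} (hA : A = a' / c') (hB : B = a / c)
    (hx : x = (d * a' - b * c' : ℤ) / (a * c' - c * a' : ℤ)) :
    ((A : ℂ) - B) ^ m * I ^ (m + 1) * vint f x m =
      (∫ t in Set.Ioi (0 : ℝ), kernel f m A B 1 0 0 1 (A + t * I) * I) -
        ∫ t in Set.Ioi (0 : ℝ), kernel f m B A 1 0 0 1 (B + t * I) * I := by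
  have hkE : Even k := ⟨m + 1, by omega⟩
  have hcR : (0 : ℝ) < c := by exact_mod_cast hc
  have hcR' : (0 : ℝ) < c' := by exact_mod_cast hc'
  have hDR : (0 : ℝ) < a * c' - c * a' := by exact_mod_cast hD
  have hdetR : (a * d - b * c : ℝ) = 1 := by exact_mod_cast hdet
  have hdetR' : (a' * d' - b' * c' : ℝ) = 1 := by exact_mod_cast hdet'
  have hAR : (A : ℝ) = a' / c' := by rw [hA]; push_cast; rfl
  have hBR : (B : ℝ) = a / c := by rw [hB]; push_cast; rfl
  have hxR : (x : ℝ) = (d * a' - b * c') / (a * c' - c * a') := by rw [hx]; push_cast; rfl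
  -- Each side is a difference of two of the limits V, VA, VB of a single primitive at ∞, A, B.
  obtain ⟨G, hG⟩ := exists_primitive_upperHalfPlane
    (h := kernel f m A B 1 0 0 1) fun z hz => differentiableAt_kernel f m A B 1 0 0 1 hz
  obtain ⟨V, hV⟩ := exists_cusp_limit f hk hG (a := 1) (b := 0) (c := 0) (d := 1) (by norm_num)
  obtain ⟨VA, hVA⟩ := exists_cusp_limit f hk hG hdet'
  obtain ⟨VB, hVB⟩ := exists_cusp_limit f hk hG hdet
  simp only [Int.cast_one, Int.cast_zero, one_mul, zero_mul, add_zero, zero_add, div_one] at hV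
  have hlineA : ∫ t in Set.Ioi (0 : ℝ), kernel f m A B 1 0 0 1 (A + t * I) * I = V - VA := by
    refine integral_Ioi_eq_of_tendsto (φ := fun t : ℝ => G ((A : ℝ) + t * I)) (fun t ht => ?_)
      (integrableOn_kernel_vertical f hkE m A B) ?_ (hV A)
    · have := hasDerivAt_comp_vertical (x := A) (t := t) (hG (A + t * I) (by simpa using ht))
      simpa using this
    · refine tendsto_zero_of_tendsto_inv (C := (c' : ℝ) ^ 2) (by positivity) (fun t ht => ?_)
        (hVA (-d' / c' : ℝ))
      have h := moebius_above_pole hdetR' hcR'.ne' (s := ((c' : ℝ) ^ 2 * t)⁻¹) (by positivity)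
      rw [show ((c' : ℝ) ^ 2 * ((c' : ℝ) ^ 2 * t)⁻¹)⁻¹ = t by field_simp] at h
      simp only [ofReal_intCast] at h
      rw [h, hAR]
  have hlineB : ∫ t in Set.Ioi (0 : ℝ), kernel f m B A 1 0 0 1 (B + t * I) * I = V - VB := by
    refine integral_Ioi_eq_of_tendsto (φ := fun t : ℝ => G ((B : ℝ) + t * I)) (fun t ht => ?_)
      (integrableOn_kernel_vertical f hkE m B A) ?_ (hV B)
    · have := hasDerivAt_comp_vertical (x := B) (t := t) (hG (B + t * I) (by simpa using ht))
      rw [kernel_one_symm f m A B] at this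
      simpa using this
    · refine tendsto_zero_of_tendsto_inv (C := (c : ℝ) ^ 2) (by positivity) (fun t ht => ?_)
        (hVB (-d / c : ℝ))
      have h := moebius_above_pole hdetR hcR.ne' (s := ((c : ℝ) ^ 2 * t)⁻¹) (by positivity)
      rw [show ((c : ℝ) ^ 2 * ((c : ℝ) ^ 2 * t)⁻¹)⁻¹ = t by field_simp] at h
      simp only [ofReal_intCast] at h
      rw [h, hBR]
  -- The matrix sends ∞ to B and x to A: the factor of B pulls back to the constant -1/c, and the
  -- factor of A to a linear function vanishing at x.
  have hker (t : ℝ) : kernel f m A B a b c d (x + t * I) * I =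
      (((A : ℂ) - B) ^ m * I ^ (m + 1)) * (onPlane f (x + t * I) * (t : ℂ) ^ m) := by
    have hcC : (c : ℂ) ≠ 0 := by exact_mod_cast hc.ne'
    have hcC' : (c' : ℂ) ≠ 0 := by exact_mod_cast hc'.ne'
    have hDC : (a * c' - c * a' : ℂ) ≠ 0 := by exact_mod_cast hD.ne'
    have hdetC : (a * d - b * c : ℂ) = 1 := by exact_mod_cast hdet
    have hAC : (A : ℂ) = a' / c' := by rw [hA]; push_cast; rfl
    have hBC : (B : ℂ) = a / c := by rw [hB]; push_cast; rfl
    have hxC : (x : ℂ) = (d * a' - b * c') / (a * c' - c * a') := by rw [hx]; push_cast; rfl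
    have e : (((a - A * c : ℝ) : ℂ) * (x + t * I) + (b - A * d : ℝ)) *
        (((a - B * c : ℝ) : ℂ) * (x + t * I) + (b - B * d : ℝ)) = (A - B) * t * I := by
      push_cast
      have e1 : (a - B * c : ℂ) = 0 := by rw [hBC]; field_simp; ring
      have e2 : (b - B * d : ℂ) = -1 / c := by
        rw [hBC]
        field_simp
        linear_combination -hdetC
      have e3 : (a - A * c : ℂ) * x + (b - A * d) = 0 := by
        have hx' : (x : ℂ) * (a * c' - c * a') = d * a' - b * c' := by
          rw [hxC, div_mul_cancel₀ _ hDC]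
        have hA' : (A : ℂ) * c' = a' := by rw [hAC, div_mul_cancel₀ _ hcC']
        refine mul_left_cancel₀ hcC' ?_
        linear_combination (-(c * x) - d : ℂ) * hA' + hx'
      have e4 : (a - A * c : ℂ) = (B - A) * c := by rw [hBC]; field_simp
      rw [e1, e2, zero_mul, zero_add,
        show (a - A * c : ℂ) * (x + t * I) + (b - A * d) =
          ((a - A * c) * x + (b - A * d)) + (a - A * c) * (t * I) by ring, e3, e4]
      field_simp
      ring
    rw [kernel, e, mul_pow, mul_pow]
    ring
  have hlineX : ∫ t in Set.Ioi (0 : ℝ), kernel f m A B a b c d (x + t * I) * I = VB - VA := by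
    refine integral_Ioi_eq_of_tendsto
      (φ := fun t : ℝ => G ((a * ((x : ℝ) + t * I) + b) / (c * ((x : ℝ) + t * I) + d)))
      (fun t ht => ?_) ?_ ?_ (hVB x)
    · have h1 := hasDerivAt_primitive_comp_moebius f hk hG hdet (w := (x : ℝ) + t * I)
        (by simpa using ht)
      have := hasDerivAt_comp_vertical h1
      simpa using this
    · simp only [hker]
      exact (integrableOn_vint f hkE x m).const_mul _
    -- The lower row (D, e) belongs to γ⁻¹γ', where γ and γ' are the matrices with γ∞ = B and γ'∞ =
    -- A. As this product sends ∞ to x and γ(γ⁻¹γ') = γ', the limit at x is the one already known at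
    -- A.
    · set D : ℝ := a * c' - c * a' with hDdef
      set e : ℝ := a * d' - c * b' with hedef
      refine tendsto_zero_of_tendsto_inv (C := D ^ 2) (by positivity) (fun t ht => ?_)
        (hVA (-e / D))
      have hs : 0 < (D ^ 2 * t)⁻¹ := by positivity
      have hdet3 : (d * a' - b * c' : ℝ) * e - (d * b' - b * d') * D = 1 := by
        rw [hedef, hDdef]
        linear_combination (a' * d' - b' * c' : ℝ) * hdetR + hdetR'
      have h := moebius_above_pole hdet3 hDR.ne' (s := (D ^ 2 * t)⁻¹) hs.ne'
      rw [show (D ^ 2 * (D ^ 2 * t)⁻¹)⁻¹ = t by field_simp, ← hxR] at h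
      rw [← h]
      set w : ℂ := ((-e / D : ℝ) : ℂ) + ((D ^ 2 * t)⁻¹ : ℝ) * I with hw
      have hwim : 0 < w.im := by
        simpa only [hw, add_im, ofReal_im, mul_im, ofReal_re, I_im, I_re, mul_one, mul_zero, add_zero,
          zero_add] using hs
      have hden := denom_ne_zero hdet3 hwim
      have hden' := denom_ne_zero hdetR' hwim
      simp only [ofReal_intCast] at hden'
      congr 1
      have hdetC : (a * d - b * c : ℂ) = 1 := by exact_mod_cast hdet
      have e1 (u v : ℂ) : u * ((((d * a' - b * c' : ℝ) : ℂ) * w + (d * b' - b * d' : ℝ)) /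
          ((D : ℂ) * w + e)) + v = (u * (((d * a' - b * c' : ℝ) : ℂ) * w + (d * b' - b * d' : ℝ)) +
            v * ((D : ℂ) * w + e)) / ((D : ℂ) * w + e) := by
        rw [eq_div_iff hden, add_mul, mul_assoc, div_mul_cancel₀ _ hden]
      rw [e1, e1, div_div_div_cancel_right₀ hden]
      rw [hDdef, hedef]
      push_cast
      congr 1
      · linear_combination (a' * w + b' : ℂ) * hdetC
      · linear_combination (c' * w + d' : ℂ) * hdetC
  rw [hlineA, hlineB, sub_sub_sub_cancel_left, ← hlineX]
  simp only [hker]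
  rw [integral_const_mul, vint]

end VerticalIntegral

end HeckeReciprocity

/-! ### Uniform bound for the triangle defect. -/

namespace HeckeReciprocity

open Complex Filter Topology MeasureTheory

section PeriodBound

variable {k : ℕ} (f : CuspForm 𝒮ℒ (k : ℤ))

/-- The bounds for the exponents n and n + 2 are added; the factor 1/(1 + y²) makes the majorant
integrable uniformly in the real part. -/
lemma exists_pow_im_mul_norm_le_div {n : ℕ} (hn : k ≤ 2 * n) :
    ∃ K, 0 ≤ K ∧ ∀ z : ℂ, 0 < z.im → z.im ^ n * ‖onPlane f z‖ ≤ K / (1 + z.im ^ 2) := by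
  obtain ⟨K₁, h₁, hK₁⟩ := exists_pow_im_mul_norm_le f (n := n) hn
  obtain ⟨K₂, h₂, hK₂⟩ := exists_pow_im_mul_norm_le f (n := n + 2) (by omega)
  refine ⟨K₁ + K₂, by positivity, fun z hz => ?_⟩
  rw [le_div_iff₀ (by positivity)]
  calc z.im ^ n * ‖onPlane f z‖ * (1 + z.im ^ 2)
      = z.im ^ n * ‖onPlane f z‖ + z.im ^ (n + 2) * ‖onPlane f z‖ := by ring
    _ ≤ K₁ + K₂ := add_le_add (hK₁ z hz) (hK₂ z hz)

/-- The difference gains a factor x. Multiplying by δ avoids the exponent m - 1, so m = 0 needs no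
exception. -/
lemma norm_add_pow_sub_pow_le (m : ℕ) {x y : ℂ} {δ : ℝ} (hδ : 0 ≤ δ) (hx : ‖x‖ ≤ δ)
    (hy : ‖y‖ ≤ δ) : δ * ‖(x + y) ^ m - y ^ m‖ ≤ ‖x‖ * (3 ^ m * δ ^ m) := by
  induction m with
  | zero => simp
  | succ m ih =>
    have e : (x + y) ^ (m + 1) - y ^ (m + 1) = (x + y) * ((x + y) ^ m - y ^ m) + x * y ^ m := by
      ring
    have h3 : (1 : ℝ) ≤ 3 ^ m := one_le_pow₀ (by norm_num)
    calc δ * ‖(x + y) ^ (m + 1) - y ^ (m + 1)‖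
        ≤ δ * ((δ + δ) * ‖(x + y) ^ m - y ^ m‖ + ‖x‖ * δ ^ m) := by
          rw [e]
          gcongr
          refine (norm_add_le _ _).trans ?_
          rw [norm_mul, norm_mul, norm_pow]
          gcongr
          exact (norm_add_le _ _).trans (add_le_add hx hy)
      _ = 2 * δ * (δ * ‖(x + y) ^ m - y ^ m‖) + ‖x‖ * (1 * δ ^ (m + 1)) := by ring
      _ ≤ 2 * δ * (‖x‖ * (3 ^ m * δ ^ m)) + ‖x‖ * (3 ^ m * δ ^ (m + 1)) := by gcongr
      _ = _ := by ring

variable {f}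

/-- Near a cusp the kernel is approximated by its leading term. -/
lemma norm_integral_kernel_sub_le {m : ℕ} (hk : k = 2 * m + 2) {K : ℝ} (hK0 : 0 ≤ K)
    (hK : ∀ z : ℂ, 0 < z.im → z.im ^ (m + 1) * ‖onPlane f z‖ ≤ K / (1 + z.im ^ 2))
    (A : ℚ) (B : ℝ) {δ : ℝ} (hδ : 0 < δ) (hAB : |A - B| = δ) :
    ‖(∫ t in Set.Ioi (0 : ℝ), kernel f m A B 1 0 0 1 (A + t * I) * I) -
        (((A : ℂ) - B) ^ m * I ^ (m + 1)) * vint f A m -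
        ∫ t in Set.Ioi δ, kernel f m A B 1 0 0 1 (A + t * I) * I‖ ≤
      (K * 3 ^ m * ∫ t in Set.Ioi (0 : ℝ), (1 + t ^ 2)⁻¹) * (δ ^ m / δ) := by
  have hkE : Even k := ⟨m + 1, by omega⟩
  have hi1 := integrableOn_kernel_vertical f hkE m A B
  have hi2 := (integrableOn_vint f hkE A m).const_mul (((A : ℂ) - B) ^ m * I ^ (m + 1))
  have hind : ∫ t in Set.Ioi δ, kernel f m A B 1 0 0 1 (A + t * I) * I =
      ∫ t in Set.Ioi (0 : ℝ), (Set.Ioi δ).indicator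
        (fun t : ℝ => kernel f m A B 1 0 0 1 (A + t * I) * I) t := by
    rw [setIntegral_indicator measurableSet_Ioi, Set.Ioi_inter_Ioi, max_eq_right hδ.le]
  have hi3 : IntegrableOn ((Set.Ioi δ).indicator
      (fun t : ℝ => kernel f m A B 1 0 0 1 (A + t * I) * I)) (Set.Ioi 0) :=
    hi1.indicator measurableSet_Ioi
  have hnormAB : ‖(A : ℂ) - B‖ = δ := by
    rw [← hAB, ← Real.norm_eq_abs, ← norm_real]
    push_cast
    rfl
  have hi4 : IntegrableOn (fun t : ℝ => kernel f m A B 1 0 0 1 (A + t * I) * I -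
      ((A : ℂ) - B) ^ m * I ^ (m + 1) * (onPlane f (A + t * I) * (t : ℂ) ^ m)) (Set.Ioi 0) :=
    hi1.sub hi2
  rw [hind, vint, ← integral_const_mul, ← integral_sub hi1 hi2, ← integral_sub hi4 hi3]
  have hg : IntegrableOn (fun t : ℝ => K * 3 ^ m * (δ ^ m / δ) * (1 + t ^ 2)⁻¹) (Set.Ioi 0) :=
    integrable_inv_one_add_sq.integrableOn.const_mul _
  refine (norm_integral_le_of_norm_le hg ((ae_restrict_iff' measurableSet_Ioi).mpr
    (ae_of_all _ fun t ht => ?_))).trans (le_of_eq ?_)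
  · have ht' : 0 < t := ht
    have hF := hK (A + t * I) (by simpa using ht')
    simp only [add_im, ratCast_im, mul_im, ofReal_re, I_im, mul_one, ofReal_im, I_re, mul_zero,
      add_zero, zero_add] at hF
    have h3 : (1 : ℝ) ≤ 3 ^ m := one_le_pow₀ (by norm_num)
    have hgoal : K * 3 ^ m * (δ ^ m / δ) * (1 + t ^ 2)⁻¹ =
        (K / (1 + t ^ 2)) * (3 ^ m * δ ^ m) / δ := by ring
    rw [hgoal, le_div_iff₀ hδ]
    -- Above δ only the subtracted leading term remains, and δ ≤ t supplies the missing power of t.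
    -- Below δ the kernel minus its leading term gains a factor t.
    by_cases h : t ∈ Set.Ioi δ
    · have hδt : δ < t := h
      rw [Set.indicator_of_mem h, sub_right_comm, sub_self, zero_sub, norm_neg, norm_mul, norm_mul,
        norm_mul, norm_pow, norm_pow, norm_pow, hnormAB, norm_I, one_pow, mul_one, norm_real,
        Real.norm_of_nonneg ht'.le]
      calc δ ^ m * (‖onPlane f (A + t * I)‖ * t ^ m) * δ
          ≤ δ ^ m * (‖onPlane f (A + t * I)‖ * t ^ m) * t := by gcongr
        _ = (t ^ (m + 1) * ‖onPlane f (A + t * I)‖) * (1 * δ ^ m) := by ring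
        _ ≤ (K / (1 + t ^ 2)) * (3 ^ m * δ ^ m) := by gcongr
    · have hδt : t ≤ δ := not_lt.mp h
      rw [Set.indicator_of_notMem h, sub_zero, kernel_vertical]
      have e : onPlane f (A + t * I) * (t * I * (t * I + (A - B))) ^ m * I -
          ((A : ℂ) - B) ^ m * I ^ (m + 1) * (onPlane f (A + t * I) * (t : ℂ) ^ m) =
          onPlane f (A + t * I) * (t : ℂ) ^ m * I ^ (m + 1) *
            ((t * I + (A - B)) ^ m - (A - B) ^ m) := by
        rw [mul_pow, mul_pow]
        ring
      have hti : ‖(t * I : ℂ)‖ = t := by simp [abs_of_pos ht']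
      have h4 := norm_add_pow_sub_pow_le m (x := t * I) (y := A - B) hδ.le (by rw [hti]; exact hδt)
        hnormAB.le
      rw [hti] at h4
      rw [e, norm_mul, norm_mul, norm_mul, norm_pow, norm_pow, norm_I, one_pow, mul_one, norm_real,
        Real.norm_of_nonneg ht'.le]
      calc ‖onPlane f (A + t * I)‖ * t ^ m * ‖(t * I + (A - B) : ℂ) ^ m - (A - B) ^ m‖ * δ
          = ‖onPlane f (A + t * I)‖ * t ^ m * (δ * ‖(t * I + (A - B) : ℂ) ^ m - (A - B) ^ m‖) := by
            ring
        _ ≤ ‖onPlane f (A + t * I)‖ * t ^ m * (t * (3 ^ m * δ ^ m)) := by gcongr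
        _ = (t ^ (m + 1) * ‖onPlane f (A + t * I)‖) * (3 ^ m * δ ^ m) := by ring
        _ ≤ (K / (1 + t ^ 2)) * (3 ^ m * δ ^ m) := by gcongr
  · rw [integral_const_mul]
    ring

/-- Above height `B - A` the two vertical lines differ by a horizontal segment. -/
lemma norm_integral_kernel_Ioi_sub_le {m : ℕ} (hk : k = 2 * m + 2) {K : ℝ} (hK0 : 0 ≤ K)
    (hK : ∀ z : ℂ, 0 < z.im → z.im ^ (m + 1) * ‖onPlane f z‖ ≤ K / (1 + z.im ^ 2))
    {A B : ℚ} {δ : ℝ} (hδ : 0 < δ) (hAB : (B : ℝ) - A = δ) :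
    ‖(∫ t in Set.Ioi δ, kernel f m A B 1 0 0 1 (A + t * I) * I) -
        ∫ t in Set.Ioi δ, kernel f m B A 1 0 0 1 (B + t * I) * I‖ ≤
      (K * 4 ^ m) * (δ ^ m / δ) := by
  have hkE : Even k := ⟨m + 1, by omega⟩
  obtain ⟨G, hG⟩ := exists_primitive_upperHalfPlane
    (h := kernel f m A B 1 0 0 1) fun z hz => differentiableAt_kernel f m A B 1 0 0 1 hz
  obtain ⟨V, hV⟩ := exists_cusp_limit f hk hG (a := 1) (b := 0) (c := 0) (d := 1) (by norm_num)
  simp only [Int.cast_one, Int.cast_zero, one_mul, zero_mul, add_zero, zero_add, div_one] at hV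
  have hline (x : ℚ) (hi : IntegrableOn (fun t : ℝ => kernel f m A B 1 0 0 1 (x + t * I) * I)
      (Set.Ioi 0)) :
      ∫ t in Set.Ioi δ, kernel f m A B 1 0 0 1 (x + t * I) * I = V - G ((x : ℝ) + δ * I) := by
    refine integral_Ioi_of_hasDerivAt_of_tendsto' (f := fun t : ℝ => G ((x : ℝ) + t * I))
      (fun t ht => ?_) (hi.mono_set (Set.Ioi_subset_Ioi hδ.le)) (hV x)
    have ht' : 0 < t := hδ.trans_le ht
    have := hasDerivAt_comp_vertical (x := x) (t := t) (hG (x + t * I) (by simpa using ht'))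
    simpa using this
  rw [kernel_one_symm f m B A, hline A (integrableOn_kernel_vertical f hkE m A B),
    hline B (by rw [kernel_one_symm f m A B]; exact integrableOn_kernel_vertical f hkE m B A),
    sub_sub_sub_cancel_left]
  have hle : (A : ℝ) ≤ B := by linarith
  -- The segment at height δ has length δ, and on it both linear factors have norm at most 2δ.
  have h := Convex.norm_image_sub_le_of_norm_hasDerivWithin_le (𝕜 := ℝ)
    (f := fun u : ℝ => G (u + δ * I)) (f' := fun u : ℝ => kernel f m A B 1 0 0 1 (u + δ * I))
    (s := Set.Icc (A : ℝ) B) (C := K * 4 ^ m * (δ ^ m / δ) / δ) (x := A) (y := B) ?_ ?_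
    (convex_Icc _ _) (Set.left_mem_Icc.mpr hle) (Set.right_mem_Icc.mpr hle)
  · rw [hAB, Real.norm_of_nonneg hδ.le, div_mul_cancel₀ _ hδ.ne'] at h
    exact h
  · intro u _
    have h2 : HasDerivAt (fun u : ℝ => (u + δ * I : ℂ)) 1 u := by
      simpa using (hasDerivAt_id u).ofReal_comp.add_const (δ * I)
    have h3 := (hG (u + δ * I) (by simpa using hδ)).comp u h2
    rw [mul_one] at h3
    exact h3.hasDerivWithinAt
  · intro u hu
    have hF := hK (u + δ * I) (by simpa using hδ)
    simp only [add_im, ofReal_im, mul_im, ofReal_re, I_im, mul_one, I_re, mul_zero, add_zero,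
      zero_add] at hF
    have hlin (X : ℝ) (h1 : |u - X| ≤ δ) :
        ‖((1 - X * 0 : ℝ) : ℂ) * (u + δ * I) + (0 - X * 1 : ℝ)‖ ≤ 2 * δ := by
      rw [show ((1 - X * 0 : ℝ) : ℂ) * (u + δ * I) + (0 - X * 1 : ℝ) =
        ((u - X : ℝ) : ℂ) + (δ : ℂ) * I by push_cast; ring]
      refine (norm_add_le _ _).trans ?_
      rw [norm_mul, norm_I, mul_one, norm_real, norm_real, Real.norm_eq_abs,
        Real.norm_of_nonneg hδ.le]
      linarith
    have hA := hlin A (by rw [abs_le]; constructor <;> linarith [hu.1, hu.2])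
    have hB := hlin B (by rw [abs_le]; constructor <;> linarith [hu.1, hu.2])
    rw [kernel, norm_mul, norm_pow, norm_mul]
    have hδ2 : K / (1 + δ ^ 2) ≤ K / δ := by
      gcongr
      nlinarith [sq_nonneg (δ - 1)]
    rw [le_div_iff₀ hδ]
    have hpow : (0 : ℝ) < δ ^ m := by positivity
    calc ‖onPlane f (u + δ * I)‖ * (‖((1 - A * 0 : ℝ) : ℂ) * (u + δ * I) + (0 - A * 1 : ℝ)‖ *
          ‖((1 - B * 0 : ℝ) : ℂ) * (u + δ * I) + (0 - B * 1 : ℝ)‖) ^ m * δ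
        ≤ ‖onPlane f (u + δ * I)‖ * (2 * δ * (2 * δ)) ^ m * δ := by gcongr
      _ = (δ ^ (m + 1) * ‖onPlane f (u + δ * I)‖) * (4 ^ m * δ ^ m) := by
          rw [show 2 * δ * (2 * δ) = 4 * (δ * δ) by ring, mul_pow, mul_pow]
          ring
      _ ≤ (K / δ) * (4 ^ m * δ ^ m) := by
          gcongr
          exact hF.trans hδ2
      _ = _ := by ring

/-- A bound for the period over the third side of a geodesic triangle. -/
theorem exists_norm_vint_le {m : ℕ} (hk : k = 2 * m + 2) (f : CuspForm 𝒮ℒ (k : ℤ)) :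
    ∃ C, 0 ≤ C ∧ ∀ {a b c d a' b' c' d' : ℤ}, a * d - b * c = 1 → a' * d' - b' * c' = 1 →
      0 < c → 0 < c' → 0 < a * c' - c * a' → ∀ {A B x : ℚ}, A = a' / c' → B = a / c →
      x = (d * a' - b * c' : ℤ) / (a * c' - c * a' : ℤ) →
      ‖vint f x m - vint f A m + (-1) ^ m * vint f B m‖ ≤ C / (B - A) := by
  obtain ⟨K, hK0, hK⟩ := exists_pow_im_mul_norm_le_div f (n := m + 1) (by omega)
  have hJ : 0 ≤ ∫ t in Set.Ioi (0 : ℝ), (1 + t ^ 2)⁻¹ :=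
    setIntegral_nonneg measurableSet_Ioi fun t _ => by positivity
  set J := ∫ t in Set.Ioi (0 : ℝ), (1 + t ^ 2)⁻¹
  refine ⟨K * 3 ^ m * J + K * 3 ^ m * J + K * 4 ^ m, by positivity, ?_⟩
  intro a b c d a' b' c' d' hdet hdet' hc hc' hD A B x hA hB hx
  have hcR : (0 : ℝ) < c := by exact_mod_cast hc
  have hcR' : (0 : ℝ) < c' := by exact_mod_cast hc'
  have hDR : (0 : ℝ) < a * c' - c * a' := by exact_mod_cast hD
  set δ : ℝ := B - A with hδdef
  have hδ : 0 < δ := by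
    have : δ = (a * c' - c * a') / (c * c') := by
      rw [hδdef, hA, hB]
      push_cast
      field_simp
    rw [this]
    positivity
  have hC : ((A : ℂ) - B) = -(δ : ℂ) := by
    rw [hδdef]
    push_cast
    ring
  have hC' : ((B : ℂ) - A) = δ := by
    rw [hδdef]
    push_cast
    ring
  have h0 := integral_triangle f hk hdet hdet' hc hc' hD hA hB hx
  have h1 := norm_integral_kernel_sub_le hk hK0 hK A B hδ (by
    rw [abs_sub_comm, abs_of_pos hδ])
  have h2 := norm_integral_kernel_sub_le hk hK0 hK B A hδ (abs_of_pos hδ)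
  have h3 := norm_integral_kernel_Ioi_sub_le hk hK0 hK hδ rfl
  -- The triangle relation writes the defect, scaled by a number of modulus δ^m, as a combination of
  -- the three errors, each O(δ^m/δ).
  have e : (-(δ : ℂ)) ^ m * I ^ (m + 1) * (vint f x m - vint f A m + (-1) ^ m * vint f B m) =
      ((∫ t in Set.Ioi (0 : ℝ), kernel f m A B 1 0 0 1 (A + t * I) * I) -
        (((A : ℂ) - (B : ℝ)) ^ m * I ^ (m + 1)) * vint f A m -
        ∫ t in Set.Ioi δ, kernel f m A B 1 0 0 1 (A + t * I) * I) -
      ((∫ t in Set.Ioi (0 : ℝ), kernel f m B A 1 0 0 1 (B + t * I) * I) -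
        (((B : ℂ) - (A : ℝ)) ^ m * I ^ (m + 1)) * vint f B m -
        ∫ t in Set.Ioi δ, kernel f m B A 1 0 0 1 (B + t * I) * I) +
      ((∫ t in Set.Ioi δ, kernel f m A B 1 0 0 1 (A + t * I) * I) -
        ∫ t in Set.Ioi δ, kernel f m B A 1 0 0 1 (B + t * I) * I) := by
    have hsq : ((-1 : ℂ) ^ m) * (-1) ^ m = 1 := by rw [← mul_pow]; simp
    simp only [ofReal_ratCast]
    rw [hC] at h0
    rw [hC, hC', neg_pow] at *
    linear_combination h0 + (δ : ℂ) ^ m * I ^ (m + 1) * vint f B m * hsq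
  have hn : ‖(-(δ : ℂ)) ^ m * I ^ (m + 1)‖ = δ ^ m := by
    rw [norm_mul, norm_pow, norm_pow, norm_I, one_pow, mul_one, norm_neg, norm_real,
      Real.norm_of_nonneg hδ.le]
  have h4 := congrArg norm e
  rw [norm_mul, hn] at h4
  have hpow : (0 : ℝ) < δ ^ m := by positivity
  refine le_of_mul_le_mul_left ?_ hpow
  rw [h4]
  refine (norm_add_le _ _).trans ((add_le_add ((norm_sub_le _ _).trans (add_le_add h1 h2))
    h3).trans (le_of_eq ?_))
  ring

end PeriodBound

end HeckeReciprocity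

/-! ### The reciprocity formula: binomial terms and arithmetic of the cusps. -/

namespace HeckeReciprocity

open Complex Filter Topology MeasureTheory

section Reciprocity

variable {k : ℕ}

lemma I_pow_weight {m : ℕ} (hk : k = 2 * m + 2) : I ^ k = (-1 : ℂ) ^ (m + 1) := by
  rw [hk, show 2 * m + 2 = 2 * (m + 1) by ring, pow_mul, I_sq]

/-- The `j`-th term of the binomial expansion of the triangle relation. -/
lemma triangle_term (j l : ℕ) {δ : ℂ} (hδ : δ ≠ 0) (X Y : ℂ) :
    ((j + l).choose j : ℂ) * I ^ (j + l + 1 + j) * (-δ) ^ l * X -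
        ((j + l).choose j : ℂ) * I ^ (j + l + 1 + j) * δ ^ l * Y =
      (-δ) ^ (j + l) * I ^ (j + l + 1) * (((j + l).factorial : ℂ) *
        ((j.factorial : ℂ)⁻¹ * (l.factorial : ℂ)⁻¹ * (I * δ) ^ (-(j : ℤ)) *
          (X + (-1) ^ j * (-1) ^ (j + l + 1) * Y))) := by
  have hch : ((j + l).choose j : ℂ) =
      ((j + l).factorial : ℂ) * ((j.factorial : ℂ)⁻¹ * (l.factorial : ℂ)⁻¹) := by
    have h := Nat.choose_mul_factorial_mul_factorial (Nat.le_add_right j l)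
    rw [Nat.add_sub_cancel_left] at h
    have h' : ((j + l).choose j : ℂ) * j.factorial * l.factorial = (j + l).factorial := by
      exact_mod_cast h
    have h1 : (j.factorial : ℂ) ≠ 0 := by exact_mod_cast j.factorial_ne_zero
    have h2 : (l.factorial : ℂ) ≠ 0 := by exact_mod_cast l.factorial_ne_zero
    rw [← h']
    field_simp
  have hpow : (I * δ) ^ (-(j : ℤ)) * δ ^ j = (-1) ^ j * I ^ j := by
    rw [zpow_neg, zpow_natCast, mul_pow, mul_inv, ← inv_pow, inv_I, neg_pow, mul_assoc,
      inv_mul_cancel₀ (pow_ne_zero j hδ), mul_one]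
  have h1 : ((-1 : ℂ) ^ j) * (-1) ^ j = 1 := by rw [← mul_pow]; simp
  have h2 : ((-1 : ℂ) ^ l) * (-1) ^ l = 1 := by rw [← mul_pow]; simp
  have hP (c Z : ℂ) : (-1) ^ (j + l) * δ ^ (j + l) * I ^ (j + l + 1) *
      (c * (I * δ) ^ (-(j : ℤ)) * Z) =
      c * (-1) ^ l * δ ^ l * I ^ (j + l + 1 + j) * Z := by
    calc _ = c * ((-1) ^ j * ((I * δ) ^ (-(j : ℤ)) * δ ^ j)) * (-1) ^ l * δ ^ l *
          I ^ (j + l + 1) * Z := by ring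
      _ = c * ((-1) ^ j * (-1) ^ j) * (-1) ^ l * δ ^ l * I ^ (j + l + 1 + j) * Z := by
          rw [hpow]
          ring
      _ = _ := by rw [h1, mul_one]
  have hY : (-1 : ℂ) ^ l * ((-1) ^ j * (-1) ^ (j + l + 1)) = -1 := by
    calc _ = -(((-1 : ℂ) ^ l * (-1) ^ l) * ((-1) ^ j * (-1) ^ j)) := by ring
      _ = -1 := by rw [h1, h2, one_mul]
  rw [neg_pow δ l, neg_pow δ (j + l), ← mul_assoc ((j + l).factorial : ℂ),
    ← mul_assoc ((j + l).factorial : ℂ), ← hch, hP]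
  linear_combination (-((j + l).choose j : ℂ) * δ ^ l * I ^ (j + l + 1 + j) * Y) * hY

/-- The reciprocity relation in terms of additive twists. -/
theorem LAdd_triangle {f : CuspForm 𝒮ℒ (k : ℤ)} (hf : IsHeckeCuspForm f) {m : ℕ}
    (hk : k = 2 * m + 2) {a b c d a' b' c' d' : ℤ}
    (hdet : a * d - b * c = 1) (hdet' : a' * d' - b' * c' = 1) (hc : 0 < c) (hc' : 0 < c')
    (hD : 0 < a * c' - c * a') {A B x : ℚ} (hA : A = a' / c') (hB : B = a / c)
    (hx : x = (d * a' - b * c' : ℤ) / (a * c' - c * a' : ℤ)) :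
    LAdd f x (1 / 2) - LAdd f (-d / c) (1 / 2) - LAdd f A (1 / 2) =
      ∑ j ∈ Finset.Icc 1 (k / 2 - 1), 1 / (j.factorial : ℂ) *
        (Gamma ((k : ℂ) / 2 + j) / Gamma ((k : ℂ) / 2 - j)) *
        (2 * Real.pi * I * ((B - A : ℚ) : ℂ)) ^ (-(j : ℤ)) *
        (LAdd f A (1 / 2 + j) + (-1) ^ j * I ^ k * LAdd f B (1 / 2 + j)) := by
  have hkE : Even k := ⟨m + 1, by omega⟩
  have hδ : ((B - A : ℚ) : ℂ) ≠ 0 := by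
    have hc0 : (c : ℚ) ≠ 0 := by exact_mod_cast hc.ne'
    have hc0' : (c' : ℚ) ≠ 0 := by exact_mod_cast hc'.ne'
    have hD0 : (a * c' - c * a' : ℚ) ≠ 0 := by exact_mod_cast hD.ne'
    have : B - A = (a * c' - c * a') / (c * c') := by
      rw [hA, hB]
      field_simp
    rw [Rat.cast_ne_zero, this]
    exact div_ne_zero hD0 (mul_ne_zero hc0 hc0')
  set δ : ℂ := ((B - A : ℚ) : ℂ) with hδdef
  have hAB : (A : ℂ) - B = -δ := by rw [hδdef]; push_cast; ring
  have hBA : (B : ℂ) - A = δ := by rw [hδdef]; push_cast; ring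
  have h2pi : (2 * Real.pi : ℂ) ≠ 0 := by simp [Real.pi_ne_zero]
  have hL0 (α : ℚ) : LAdd f α (1 / 2) =
      (2 * Real.pi : ℂ) ^ (m + 1) * (m.factorial : ℂ)⁻¹ * vint f α m / coeff f 1 := by
    simpa using LAdd_half_add hf hk α 0
  have hfe := vint_functional_equation f hk hdet hc
  rw [← hB] at hfe
  have htri := integral_triangle f hk hdet hdet' hc hc' hD hA hB hx
  rw [integral_kernel_vertical f hkE m A B, integral_kernel_vertical f hkE m B A,
    ← Finset.sum_sub_distrib] at htri
  simp only [ofReal_ratCast] at htri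
  rw [hAB, hBA] at htri
  have hterm : ∀ j ∈ Finset.range (m + 1),
      (m.choose j * I ^ (m + 1 + j) * (-δ) ^ (m - j)) * vint f A (m + j) -
        (m.choose j * I ^ (m + 1 + j) * δ ^ (m - j)) * vint f B (m + j) =
      (-δ) ^ m * I ^ (m + 1) * ((m.factorial : ℂ) * ((j.factorial : ℂ)⁻¹ *
        ((m - j).factorial : ℂ)⁻¹ * (I * δ) ^ (-(j : ℤ)) *
          (vint f A (m + j) + (-1) ^ j * I ^ k * vint f B (m + j)))) := by
    intro j hj
    obtain ⟨l, rfl⟩ := Nat.exists_eq_add_of_le (Nat.lt_succ_iff.mp (Finset.mem_range.mp hj))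
    have h := triangle_term j l hδ (vint f A (j + l + j)) (vint f B (j + l + j))
    rw [Nat.add_sub_cancel_left, I_pow_weight hk]
    exact h
  rw [Finset.sum_congr rfl hterm, ← Finset.mul_sum, ← Finset.mul_sum] at htri
  have hne : (-δ) ^ m * I ^ (m + 1) ≠ 0 :=
    mul_ne_zero (pow_ne_zero _ (neg_ne_zero.mpr hδ)) (pow_ne_zero _ I_ne_zero)
  have hx' := mul_left_cancel₀ hne htri
  have hm0 : (m.factorial : ℂ) ≠ 0 := by exact_mod_cast m.factorial_ne_zero
  -- The split-off term j = 0 holds the central values at A and B; the others form the right-hand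
  -- side.
  rw [Finset.sum_range_succ'] at hx'
  have hsum : ∑ j ∈ Finset.Icc 1 (k / 2 - 1), 1 / (j.factorial : ℂ) *
        (Gamma ((k : ℂ) / 2 + j) / Gamma ((k : ℂ) / 2 - j)) *
        (2 * Real.pi * I * δ) ^ (-(j : ℤ)) *
        (LAdd f A (1 / 2 + j) + (-1) ^ j * I ^ k * LAdd f B (1 / 2 + j)) =
      (2 * Real.pi : ℂ) ^ (m + 1) / coeff f 1 * ∑ i ∈ Finset.range m,
        (((i + 1).factorial : ℂ)⁻¹ *
        ((m - (i + 1)).factorial : ℂ)⁻¹ * (I * δ) ^ (-((i + 1 : ℕ) : ℤ)) *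
          (vint f A (m + (i + 1)) + (-1) ^ (i + 1) * I ^ k * vint f B (m + (i + 1)))) := by
    have hIcc : Finset.Icc 1 (k / 2 - 1) = Finset.Ico 1 (m + 1) := by
      ext j
      simp only [Finset.mem_Icc, Finset.mem_Ico]
      omega
    rw [hIcc, Finset.sum_Ico_eq_sum_range, Nat.add_sub_cancel, Finset.mul_sum]
    refine Finset.sum_congr rfl fun i hi => ?_
    rw [add_comm 1 i]
    have hi' : i + 1 ≤ m := Finset.mem_range.mp hi
    generalize i + 1 = j at hi' ⊢
    obtain ⟨l, rfl⟩ := Nat.exists_eq_add_of_le hi'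
    have hkC : (k : ℂ) / 2 = ((j + l : ℕ) : ℂ) + 1 := by
      rw [hk]
      push_cast
      ring
    rw [show (k : ℂ) / 2 + j = ((j + l + j : ℕ) : ℂ) + 1 by rw [hkC]; push_cast; ring,
      show (k : ℂ) / 2 - j = (l : ℂ) + 1 by rw [hkC]; push_cast; ring,
      Gamma_nat_eq_factorial, Gamma_nat_eq_factorial, LAdd_half_add hf hk, LAdd_half_add hf hk,
      Nat.add_sub_cancel_left]
    have h1 : ((j + l + j).factorial : ℂ) ≠ 0 := by exact_mod_cast Nat.factorial_ne_zero _
    have h2 : (2 * Real.pi * I * δ) ^ (-(j : ℤ)) * (2 * Real.pi : ℂ) ^ (j + l + j + 1) =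
        (2 * Real.pi : ℂ) ^ (j + l + 1) * (I * δ) ^ (-(j : ℤ)) := by
      rw [show (2 * Real.pi * I * δ : ℂ) = 2 * Real.pi * (I * δ) by ring, mul_zpow, zpow_neg,
        zpow_natCast, show j + l + j + 1 = j + l + 1 + j by ring, pow_add _ (j + l + 1) j]
      field_simp
    calc _ = ((2 * Real.pi * I * δ) ^ (-(j : ℤ)) * (2 * Real.pi : ℂ) ^ (j + l + j + 1)) *
          ((j.factorial : ℂ)⁻¹ * (l.factorial : ℂ)⁻¹ *
            (vint f A (j + l + j) + (-1) ^ j * I ^ k * vint f B (j + l + j))) / coeff f 1 := by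
          field_simp
      _ = _ := by
          rw [h2]
          ring
  rw [hsum, hL0, hL0, hL0, hx']
  have h0 : vint f (-d / c) m = I ^ k * vint f B m := by
    have hsq : I ^ k * I ^ k = 1 := by
      rw [I_pow_weight hk, ← mul_pow]
      simp
    rw [hfe, ← mul_assoc, hsq, one_mul]
  rw [h0]
  generalize (Finset.sum (Finset.range m) _ : ℂ) = S
  simp only [Nat.factorial_zero, Nat.cast_one, inv_one, Nat.sub_zero, Nat.cast_zero, neg_zero,
    zpow_zero, pow_zero, add_zero, one_mul, mul_one]
  field_simp
  ring

/-- Arithmetic data attached to three distinct primes and the inverse of `p` modulo `r`. -/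
lemma exists_triangle_data {p q r : ℕ} (hp : p.Prime) (hq : q.Prime) (hr : r.Prime)
    (hpq : p ≠ q) (hqr : q ≠ r) {pbar : ℤ} (hpbar : (p : ℤ) * pbar ≡ 1 [ZMOD (r : ℤ)]) :
    ∃ t b d b' d' : ℤ, p * pbar + r * t = 1 ∧ (q * t) * d - b * p = 1 ∧
      (-(pbar * q)) * d' - b' * r = 1 := by
  -- The quotient t inverts r mod p. The coprimalities below allow the columns (qt, p) and (-p̄q, r)
  -- to be completed to matrices of determinant one.
  obtain ⟨t, ht⟩ := hpbar.dvd
  have ht' : p * pbar + r * t = 1 := by linarith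
  have hqp : IsCoprime (q : ℤ) p :=
    Nat.isCoprime_iff_coprime.mpr ((Nat.coprime_primes hq hp).mpr hpq.symm)
  have hqr' : IsCoprime (q : ℤ) r :=
    Nat.isCoprime_iff_coprime.mpr ((Nat.coprime_primes hq hr).mpr hqr)
  have h1 : IsCoprime t (p : ℤ) := ⟨r, pbar, by linarith⟩
  have h2 : IsCoprime pbar (r : ℤ) := ⟨p, t, by linarith⟩
  obtain ⟨u, v, huv⟩ := hqp.mul_left h1
  obtain ⟨u', v', huv'⟩ := (h2.mul_left hqr').neg_left
  exact ⟨t, -v, u, -v', u', ht', by linarith, by linarith⟩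

lemma zmod_cast_prime_ne_zero {p q : ℕ} (hp : p.Prime) (hq : q.Prime) (h : p ≠ q) :
    (p : ZMod q) ≠ 0 := by
  rw [Ne, ZMod.natCast_eq_zero_iff]
  exact fun hd => h ((Nat.prime_dvd_prime_iff_eq hq hp).mp hd).symm

/-- The three twisted moments as central values of additive twists. -/
lemma twistedMoment_triple {f : CuspForm 𝒮ℒ (k : ℤ)} (hf : IsHeckeCuspForm f) {p q r : ℕ}
    [hp : Fact p.Prime] [hq : Fact q.Prime] [hr : Fact r.Prime] (hpq : p ≠ q) (hqr : q ≠ r)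
    (hpr : p ≠ r) {pbar t b d : ℤ} (ht : p * pbar + r * t = 1) (hdet : (q * t) * d - b * p = 1) :
    twistedMoment f p r q = LAdd f ((d * (-(pbar * q)) - b * r : ℤ) / q) (1 / 2) ∧
      twistedMoment f (-q) r p = LAdd f ((-d : ℤ) / p) (1 / 2) ∧
      twistedMoment f (-p) q r = LAdd f ((-(pbar * q) : ℤ) / r) (1 / 2) := by
  have cast_eq (N : ℕ) {x y : ℤ} (h : x = y) : (x : ZMod N) = y := by rw [h]
  refine ⟨twistedMoment_eq_LAdd hf ?_ ?_ ?_, twistedMoment_eq_LAdd hf ?_ ?_ ?_,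
    twistedMoment_eq_LAdd hf ?_ ?_ ?_⟩
  · simpa using zmod_cast_prime_ne_zero hp.out hq.out hpq
  · simpa using zmod_cast_prime_ne_zero hr.out hq.out hqr.symm
  -- Modulo q the determinant reads -bp = 1, hence p(-br) = r.
  · have h1 := cast_eq q hdet
    push_cast at h1 ⊢
    rw [ZMod.natCast_self] at h1 ⊢
    linear_combination (r : ZMod q) * h1
  · simpa using zmod_cast_prime_ne_zero hq.out hp.out hpq.symm
  · simpa using zmod_cast_prime_ne_zero hr.out hp.out hpr.symm
  -- Modulo p one has qtd = 1 and rt = 1, hence (-q)(-d) = r.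
  · have h1 := cast_eq p hdet
    have h2 := cast_eq p ht
    push_cast at h1 h2 ⊢
    rw [ZMod.natCast_self] at h1 h2
    linear_combination (r : ZMod p) * h1 - (q * d : ZMod p) * h2
  · simpa using zmod_cast_prime_ne_zero hp.out hr.out hpr
  · simpa using zmod_cast_prime_ne_zero hq.out hr.out hqr
  · have h2 := cast_eq r ht
    push_cast at h2 ⊢
    rw [ZMod.natCast_self] at h2
    linear_combination (q : ZMod r) * h2

/-- The exact reciprocity formula. -/
theorem twistedMoment_reciprocity {f : CuspForm 𝒮ℒ (k : ℤ)} (hf : IsHeckeCuspForm f) {m : ℕ}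
    (hk : k = 2 * m + 2) {p q r : ℕ} [hp : Fact p.Prime] [hq : Fact q.Prime] [hr : Fact r.Prime]
    (hpq : p ≠ q) (hqr : q ≠ r) (hpr : p ≠ r) {pbar rbar : ℤ}
    (hpbar : (p : ℤ) * pbar ≡ 1 [ZMOD (r : ℤ)]) (hrbar : (r : ℤ) * rbar ≡ 1 [ZMOD (p : ℤ)]) :
    twistedMoment f p r q - twistedMoment f (-q) r p - twistedMoment f (-p) q r =
      ∑ j ∈ Finset.Icc 1 (k / 2 - 1), 1 / (j.factorial : ℂ) *
        (Gamma ((k : ℂ) / 2 + j) / Gamma ((k : ℂ) / 2 - j)) *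
        (2 * Real.pi * I * q / (p * r)) ^ (-(j : ℤ)) *
        (LAdd f (-((pbar * q : ℤ) : ℚ) / r) (1 / 2 + j) +
          (-1) ^ j * I ^ k * LAdd f (((q * rbar : ℤ) : ℚ) / p) (1 / 2 + j)) := by
  obtain ⟨t, b, d, b', d', ht, hdet, hdet'⟩ :=
    exists_triangle_data hp.out hq.out hr.out hpq hqr hpbar
  obtain ⟨h1, h2, h3⟩ := twistedMoment_triple hf hpq hqr hpr ht hdet
  -- This is why the third side of the triangle is a twist with denominator q.
  have hDq : (q * t) * r - p * (-(pbar * q)) = (q : ℤ) := by linear_combination (q : ℤ) * ht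
  have hp0 : (0 : ℤ) < p := by exact_mod_cast hp.out.pos
  have hq0 : (0 : ℤ) < q := by exact_mod_cast hq.out.pos
  have hr0 : (0 : ℤ) < r := by exact_mod_cast hr.out.pos
  have key := LAdd_triangle hf hk hdet hdet' hp0 hr0 (by rw [hDq]; exact hq0)
    (A := ((-(pbar * q) : ℤ) : ℚ) / r) (B := ((q * t : ℤ) : ℚ) / p)
    (x := ((d * (-(pbar * q)) - b * r : ℤ) : ℚ) / q) (by push_cast; rfl) (by push_cast; rfl)
    (by rw [hDq]; push_cast; rfl)
  -- Both t and `rbar` invert r mod p, so the two fractions differ by an integer.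
  have hB (s : ℂ) : LAdd f (((q * t : ℤ) : ℚ) / p) s = LAdd f (((q * rbar : ℤ) : ℚ) / p) s := by
    refine LAdd_congr f hp.out.ne_zero ?_ s
    refine Int.ModEq.mul_left _ ?_
    rw [Int.modEq_iff_dvd]
    obtain ⟨v, hv⟩ := hrbar.dvd
    refine ⟨pbar * rbar - t * v, ?_⟩
    linear_combination (-rbar : ℤ) * ht - t * hv
  have hδ : ((((q * t : ℤ) : ℚ) / p - ((-(pbar * q) : ℤ) : ℚ) / r : ℚ) : ℂ) = q / (p * r) := by
    have hpC : (p : ℂ) ≠ 0 := by exact_mod_cast hp.out.ne_zero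
    have hrC : (r : ℂ) ≠ 0 := by exact_mod_cast hr.out.ne_zero
    have htC : (p * pbar + r * t : ℂ) = 1 := by exact_mod_cast ht
    push_cast
    field_simp
    linear_combination (q : ℂ) * htC
  rw [h1, h2, h3]
  refine Eq.trans ?_ (key.trans (Finset.sum_congr rfl fun j _ => ?_))
  · push_cast; rfl
  · rw [hδ, hB, show (2 * Real.pi * I * (q / (p * r)) : ℂ) =
      2 * Real.pi * I * q / (p * r) by ring]
    push_cast
    rfl

/-- The reciprocity defect is bounded by a constant multiple of `p r / q`. -/
theorem exists_norm_twistedMoment_le {f : CuspForm 𝒮ℒ (k : ℤ)} (hf : IsHeckeCuspForm f) {m : ℕ}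
    (hk : k = 2 * m + 2) :
    ∃ C : ℝ, ∀ (p q r : ℕ) [Fact p.Prime] [Fact q.Prime] [Fact r.Prime],
      p ≠ q → q ≠ r → p ≠ r →
        ‖twistedMoment f p r q - twistedMoment f (-q) r p - twistedMoment f (-p) q r‖ ≤
          C * ((p : ℝ) * r / q) := by
  obtain ⟨C, hC0, hC⟩ := exists_norm_vint_le hk f
  refine ⟨(2 * Real.pi) ^ (m + 1) * (m.factorial : ℝ)⁻¹ * C / ‖coeff f 1‖, ?_⟩
  intro p q r hp hq hr hpq hqr hpr
  obtain ⟨pbar, v, hpv⟩ : IsCoprime (p : ℤ) r :=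
    Nat.isCoprime_iff_coprime.mpr ((Nat.coprime_primes hp.out hr.out).mpr hpr)
  have hpbar : (p : ℤ) * pbar ≡ 1 [ZMOD (r : ℤ)] :=
    Int.modEq_iff_dvd.mpr ⟨v, by linarith⟩
  obtain ⟨t, b, d, b', d', ht, hdet, hdet'⟩ :=
    exists_triangle_data hp.out hq.out hr.out hpq hqr hpbar
  obtain ⟨h1, h2, h3⟩ := twistedMoment_triple hf hpq hqr hpr ht hdet
  have hDq : (q * t) * r - p * (-(pbar * q)) = (q : ℤ) := by linear_combination (q : ℤ) * ht
  have hp0 : (0 : ℤ) < p := by exact_mod_cast hp.out.pos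
  have hq0 : (0 : ℤ) < q := by exact_mod_cast hq.out.pos
  have hr0 : (0 : ℤ) < r := by exact_mod_cast hr.out.pos
  have key := hC hdet hdet' hp0 hr0 (by rw [hDq]; exact hq0)
    (A := ((-(pbar * q) : ℤ) : ℚ) / r) (B := ((q * t : ℤ) : ℚ) / p)
    (x := ((d * (-(pbar * q)) - b * r : ℤ) : ℚ) / q) (by push_cast; rfl) (by push_cast; rfl)
    (by rw [hDq]; push_cast; rfl)
  have hδ : ((((q * t : ℤ) : ℚ) / p : ℚ) : ℝ) - ((((-(pbar * q) : ℤ) : ℚ) / r : ℚ) : ℝ) =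
      q / (p * r) := by
    have hpC : (p : ℝ) ≠ 0 := by exact_mod_cast hp.out.ne_zero
    have hrC : (r : ℝ) ≠ 0 := by exact_mod_cast hr.out.ne_zero
    have htC : (p * pbar + r * t : ℝ) = 1 := by exact_mod_cast ht
    push_cast
    field_simp
    linear_combination (q : ℝ) * htC
  rw [hδ, div_div_eq_mul_div] at key
  have hfe := vint_functional_equation f hk hdet hp0
  have hL0 (α : ℚ) : LAdd f α (1 / 2) =
      (2 * Real.pi : ℂ) ^ (m + 1) * (m.factorial : ℂ)⁻¹ * vint f α m / coeff f 1 := by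
    simpa using LAdd_half_add hf hk α 0
  -- The sign i^k = (-1)^(m+1) of the functional equation matches the combination bounded in
  -- `exists_norm_vint_le`.
  have hv : vint f (((-d : ℤ) : ℚ) / p) m =
      -((-1) ^ m * vint f (((q * t : ℤ) : ℚ) / p) m) := by
    have hsq : ((-1 : ℂ) ^ m) * (-1) ^ m = 1 := by rw [← mul_pow]; simp
    have e : vint f (((q * t : ℤ) : ℚ) / p) m =
        (-1) ^ (m + 1) * vint f (((-d : ℤ) : ℚ) / p) m := by
      rw [← I_pow_weight hk]
      push_cast at hfe ⊢
      exact hfe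
    rw [e]
    linear_combination (-vint f (((-d : ℤ) : ℚ) / p) m) * hsq
  rw [h1, h2, h3, hL0, hL0, hL0, hv]
  set V₁ := vint f (((d * (-(pbar * q)) - b * r : ℤ) : ℚ) / q) m
  set V₂ := vint f (((q * t : ℤ) : ℚ) / p) m
  set V₃ := vint f (((-(pbar * q) : ℤ) : ℚ) / r) m
  have e : (2 * Real.pi : ℂ) ^ (m + 1) * (m.factorial : ℂ)⁻¹ * V₁ / coeff f 1 -
      (2 * Real.pi : ℂ) ^ (m + 1) * (m.factorial : ℂ)⁻¹ * (-((-1) ^ m * V₂)) / coeff f 1 -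
      (2 * Real.pi : ℂ) ^ (m + 1) * (m.factorial : ℂ)⁻¹ * V₃ / coeff f 1 =
      (2 * Real.pi : ℂ) ^ (m + 1) * (m.factorial : ℂ)⁻¹ / coeff f 1 *
        (V₁ - V₃ + (-1) ^ m * V₂) := by ring
  have hn : ‖(2 * Real.pi : ℂ) ^ (m + 1) * (m.factorial : ℂ)⁻¹ / coeff f 1‖ =
      (2 * Real.pi) ^ (m + 1) * (m.factorial : ℝ)⁻¹ / ‖coeff f 1‖ := by
    simp [abs_of_pos Real.pi_pos]
  rw [e, norm_mul, hn]
  calc _ ≤ (2 * Real.pi) ^ (m + 1) * (m.factorial : ℝ)⁻¹ / ‖coeff f 1‖ *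
        (C * (p * r) / q) := by gcongr
    _ = _ := by ring

end Reciprocity

end HeckeReciprocity

theorem theorem1 {k : ℕ} (hk : 12 ≤ k) (f : CuspForm 𝒮ℒ (k : ℤ))
    (hf : HeckeReciprocity.IsHeckeCuspForm f) :
    -- the `L`-functions involved are well defined
    ((∃ F : ℂ → ℂ, HeckeReciprocity.IsEntireContinuation (HeckeReciprocity.lam f) F) ∧
      (∀ α : ℚ, ∃ F : ℂ → ℂ,
        HeckeReciprocity.IsEntireContinuation (HeckeReciprocity.addTwistCoeff f α) F) ∧
      (∀ (N : ℕ) [NeZero N] (χ : DirichletCharacter ℂ N), ∃ F : ℂ → ℂ,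
        HeckeReciprocity.IsEntireContinuation (HeckeReciprocity.charTwistCoeff f χ) F)) ∧
    -- the exact reciprocity formula; `pbar` and `rbar` are any inverses of `p` mod `r`, `r` mod `p`
    (∀ (p q r : ℕ) [Fact p.Prime] [Fact q.Prime] [Fact r.Prime],
      p ≠ 2 → q ≠ 2 → r ≠ 2 → p ≠ q → q ≠ r → p ≠ r →
      ∀ pbar rbar : ℤ, (p : ℤ) * pbar ≡ 1 [ZMOD (r : ℤ)] → (r : ℤ) * rbar ≡ 1 [ZMOD (p : ℤ)] →
        HeckeReciprocity.twistedMoment f p r q - HeckeReciprocity.twistedMoment f (-q) r p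
            - HeckeReciprocity.twistedMoment f (-p) q r =
          ∑ j ∈ Finset.Icc 1 (k / 2 - 1),
            1 / (j.factorial : ℂ) *
              (Complex.Gamma ((k : ℂ) / 2 + j) / Complex.Gamma ((k : ℂ) / 2 - j)) *
              (2 * Real.pi * Complex.I * q / (p * r)) ^ (-(j : ℤ)) *
              (HeckeReciprocity.LAdd f (-((pbar * q : ℤ) : ℚ) / r) (1 / 2 + j) +
                (-1) ^ j * Complex.I ^ k *
                  HeckeReciprocity.LAdd f (((q * rbar : ℤ) : ℚ) / p) (1 / 2 + j))) ∧
    -- the resulting bound, with a constant depending only on `f`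
    (∃ C : ℝ, ∀ (p q r : ℕ) [Fact p.Prime] [Fact q.Prime] [Fact r.Prime],
      p ≠ 2 → q ≠ 2 → r ≠ 2 → p ≠ q → q ≠ r → p ≠ r →
        ‖HeckeReciprocity.twistedMoment f p r q - HeckeReciprocity.twistedMoment f (-q) r p
            - HeckeReciprocity.twistedMoment f (-p) q r‖ ≤ C * ((p : ℝ) * r / q)) := by
  -- Here m = k/2 - 1; the truncated subtraction is harmless since k ≥ 12.
  obtain ⟨m, hm⟩ : ∃ m, k = 2 * m + 2 := by
    obtain ⟨l, hl⟩ := HeckeReciprocity.even_of_isHeckeCuspForm hf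
    exact ⟨l - 1, by omega⟩
  refine ⟨⟨⟨_, HeckeReciprocity.isEntireContinuation_LFun hf⟩,
    fun α => ⟨_, HeckeReciprocity.isEntireContinuation_LAdd hf α⟩,
    fun N _ χ => ⟨_, HeckeReciprocity.isEntireContinuation_LChar hf χ⟩⟩, ?_, ?_⟩
  · intro p q r _ _ _ _ _ _ hpq hqr hpr pbar rbar hpbar hrbar
    exact HeckeReciprocity.twistedMoment_reciprocity hf hm hpq hqr hpr hpbar hrbar
  · obtain ⟨C, hC⟩ := HeckeReciprocity.exists_norm_twistedMoment_le hf hm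
    exact ⟨C, fun p q r _ _ _ _ _ _ hpq hqr hpr => hC p q r hpq hqr hpr⟩
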